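/- Let $n\ge 0$ and $k\ge 2$ be integers and let $1\le p<\infty$ satisfy $p>\frac{n-1}{k-1}$. Let $C>0$ and let $D\subset\mathbb R^n$ be an open set that is $C$-bi-Lipschitz homeomorphic to an open ball $B\subset\mathbb R^n$ of radius $1$, in the sense that there are mutually inverse bijections $\beta\colon D\to B$ and $\alpha\colon B\to D$ with $|\beta(x)-\beta(x')|\le C|x-x'|$ for all $x,x'\in D$ and $|\alpha(y)-\alpha(y')|\le \frac1C|y-y'|$ for all $y,y'\in B$. Let $\Omega^k_p(D)$ be the Banach space of (a.e. classes of) measurable $k$-forms $\omega=\sum_J f_J\,dx_J$ on $D$ with $\|\omega\|_{\Omega^k_p(D)}=\big(\int_D|\omega(x)|^p\,dx\big)^{1/p}<\infty$, where $|\omega(x)|=\big(\sum_J f_J(x)^2\big)^{1/2}$, the sums being over $J=\{j_1<\dots<j_k\}$. A form $\eta\in\Omega^{k+1}_p(D)$ is the differential $d\omega$ of $\omega\in\Omega^k_p(D)$ if $\int_D\omega\wedge d\phi=(-1)^{k+1}\int_D\eta\wedge\phi$ for every smooth $(n-k-1)$-form $\phi$ with compact support in $D$ (for $k\ge n$ the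 only $(k+1)$-form is $0$, and $d\omega=0$). Let $\Omega^k_{p,p}(D)=\{\omega\in\Omega^k_p(D): d\omega\text{ exists in }\Omega^{k+1}_p(D)\}$, with the norm of $\Omega^k_p(D)$, and let $$\mathcal H^k_p(D)=\Omega^k_{p,p}(D)\big/\ker\big(d\colon\Omega^k_{p,p}(D)\to\Omega^{k+1}_p(D)\big),\qquad \|[\zeta]\|_{\mathcal H^k_p(D)}=\inf\{\|\zeta+\kappa\|_{\Omega^k_p(D)}:\kappa\in\Omega^k_{p,p}(D),\ d\kappa=0\},$$ with $d[\zeta]:=d\zeta$. Then every $\omega\in\mathcal H^k_p(D)$ satisfies $$\|\omega\|_{\mathcal H^k_p(D)}\le\frac{\sqrt{\binom nk}\,(n-k+1)}{C\,(p(k-1)-n+1)^{1/p}}\left(\frac{(n!)^{\frac{p+1}{p}}}{(n-k+1)!}\right)^2\|d\omega\|_{\Omega^{k+1}_p(D)}$$ (for $k>n$, where $\binom nk=0$, the right-hand side is read as $0$). -/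

import Mathlib

open MeasureTheory
open scoped ENNReal

noncomputable section

namespace LpForms

/-- Euclidean space `ℝⁿ`. -/
abbrev E (n : ℕ) : Type := EuclideanSpace ℝ (Fin n)

/-- Alternating `k`-covectors `∑_J f_J dx_J` on `ℝⁿ`, where `J = {j₁ < ⋯ < j_k}` runs over the
`k`-element subsets of the index set, with the Euclidean norm `(∑_J f_J²)^(1/2)` that makes the
`dx_J = dx_{j₁} ∧ ⋯ ∧ dx_{j_k}` orthonormal. -/
abbrev Covector (n k : ℕ) : Type := EuclideanSpace ℝ {J : Finset (Fin n) // J.card = k}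

/-- The coefficient of `dx_J` in a `k`-covector (zero if `J` does not have `k` elements). -/
def coeff {n k : ℕ} (J : Finset (Fin n)) : Covector n k →L[ℝ] ℝ :=
  if h : J.card = k then EuclideanSpace.proj ⟨J, h⟩ else 0

/-- For disjoint `A` and `B`, the sign with `dx_A ∧ dx_B = shuffleSign A B • dx_{A ∪ B}`. -/
def shuffleSign {n : ℕ} (A B : Finset (Fin n)) : ℝ :=
  (-1) ^ ((A ×ˢ B).filter fun q => q.2 < q.1).card

/-- The exterior product of covectors. -/
def wedge {n k m : ℕ} (α : Covector n k) (β : Covector n m) : Covector n (k + m) :=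
  WithLp.toLp 2 fun J => ∑ A ∈ J.1.powerset,
    shuffleSign A (J.1 \ A) * coeff A α * coeff (J.1 \ A) β

/-- The classical exterior derivative `d(∑ φ_I dx_I) = ∑_i ∑_I ∂_i φ_I dx_i ∧ dx_I`
of a differentiable `m`-form. -/
def extDer {n m : ℕ} (φ : E n → Covector n m) (x : E n) : Covector n (m + 1) :=
  WithLp.toLp 2 fun J => ∑ i ∈ J.1,
    shuffleSign {i} (J.1.erase i) *
      fderiv ℝ (fun y => coeff (J.1.erase i) (φ y)) x (EuclideanSpace.single i 1)

/-- The integral over `D` of a form of top degree `l = n`, that is, of its coefficient at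
`dx_1 ∧ ⋯ ∧ dx_n`. -/
def integralTop {n l : ℕ} (D : Set (E n)) (θ : E n → Covector n l) : ℝ :=
  ∫ x in D, coeff Finset.univ (θ x)

/-- `η` is the differential of the `k`-form `ω` on `D` in the sense of distributions:
`∫_D ω ∧ dφ = (-1)^(k+1) ∫_D η ∧ φ` for every smooth `(n-k-1)`-form `φ` with compact support
in `D`. -/
def IsWeakDifferential {n k : ℕ} (D : Set (E n)) (ω : E n → Covector n k)
    (η : E n → Covector n (k + 1)) : Prop :=
  ∀ m : ℕ, k + 1 + m = n → ∀ φ : E n → Covector n m,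
    ContDiff ℝ (⊤ : ℕ∞) φ → HasCompactSupport φ → tsupport φ ⊆ D →
      integralTop D (fun x => wedge (ω x) (extDer φ x)) =
        (-1) ^ (k + 1) * integralTop D (fun x => wedge (η x) (φ x))

instance factOfReal (p : ℝ) [hp : Fact (1 ≤ p)] : Fact (1 ≤ ENNReal.ofReal p) :=
  ⟨ENNReal.one_le_ofReal.2 hp.out⟩

/-- The Banach space `Ω^k_p(D)` of classes of measurable `k`-forms on `D` with the norm
`(∫_D |ω(x)|^p dx)^(1/p)`. -/
abbrev Omega {n : ℕ} (D : TopologicalSpace.Opens (E n)) (k : ℕ) (p : ℝ) : Type :=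
  Lp (Covector n k) (ENNReal.ofReal p) (volume.restrict (D : Set (E n)))

section facts

variable {n k m : ℕ}

lemma coeff_self (α : Covector n k) (J : {J : Finset (Fin n) // J.card = k}) :
    coeff J.1 α = α J := by
  simp [coeff, J.2]

lemma coeff_of_ne {A : Finset (Fin n)} (h : A.card ≠ k) (α : Covector n k) : coeff A α = 0 := by
  simp [coeff, h]

lemma coeff_univ_wedge (h : k + m = n) (α : Covector n k) (β : Covector n m) :
    coeff Finset.univ (wedge α β) =
      ∑ A : Finset (Fin n), shuffleSign A Aᶜ * coeff A α * coeff Aᶜ β := by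
  have := coeff_self (wedge α β) ⟨Finset.univ, by simp [h]⟩
  rw [this]
  simp [wedge, Finset.compl_eq_univ_sdiff]

lemma shuffleSign_sq (A B : Finset (Fin n)) : shuffleSign A B * shuffleSign A B = 1 := by
  rw [shuffleSign, ← mul_pow]; simp

lemma integrable_wedge {D : TopologicalSpace.Opens (E n)} {p : ℝ} [Fact (1 ≤ p)]
    (h : k + m = n) (ω : Omega D k p) {ψ : E n → Covector n m} (hψ : Continuous ψ)
    (hc : HasCompactSupport ψ) :
    Integrable (fun x => coeff Finset.univ (wedge (ω x) (ψ x)))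
      (volume.restrict (D : Set (E n))) := by
  simp only [coeff_univ_wedge h]
  refine integrable_finsetSum _ fun A _ => ?_
  have h1 : MemLp (fun x => coeff A (ω x)) (ENNReal.ofReal p)
      (volume.restrict (D : Set (E n))) := (coeff A).comp_memLp' (Lp.memLp ω)
  have h2 := h1.locallyIntegrable (Fact.out : 1 ≤ ENNReal.ofReal p)
  have h3 : Continuous fun x => coeff Aᶜ (ψ x) := (coeff Aᶜ).continuous.comp hψ
  have h4 : HasCompactSupport fun x => coeff Aᶜ (ψ x) := hc.comp_left (g := coeff Aᶜ) (map_zero _)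
  have h5 := h2.integrable_smul_right_of_hasCompactSupport h3 h4
  simpa [mul_assoc, mul_comm, mul_left_comm, smul_eq_mul] using h5.const_mul (shuffleSign A Aᶜ)

lemma extDer_continuous {φ : E n → Covector n m} (hφ : ContDiff ℝ (⊤ : ℕ∞) φ) :
    Continuous (extDer φ) := by
  refine (PiLp.continuous_toLp 2 _).comp (continuous_pi fun J => ?_)
  refine continuous_finsetSum _ fun i _ => continuous_const.mul ?_
  have : ContDiff ℝ (⊤ : ℕ∞) fun y => coeff (J.1.erase i) (φ y) := (coeff _).contDiff.comp hφ
  exact (this.continuous_fderiv (by simp)).clm_apply continuous_const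

lemma extDer_hasCompactSupport {φ : E n → Covector n m} (hc : HasCompactSupport φ) :
    HasCompactSupport (extDer φ) := by
  refine HasCompactSupport.intro (K := tsupport φ) hc fun x hx => ?_
  have h0 : φ =ᶠ[nhds x] 0 := notMem_tsupport_iff_eventuallyEq.1 hx
  ext J
  simp only [extDer, PiLp.zero_apply]
  refine Finset.sum_eq_zero fun i _ => ?_
  have : (fun y => coeff (J.1.erase i) (φ y)) =ᶠ[nhds x] fun _ => (0 : ℝ) := by
    filter_upwards [h0] with y hy
    simp [hy]
  rw [this.fderiv_eq]
  simp

lemma integralTop_add {D : TopologicalSpace.Opens (E n)} {p : ℝ} [Fact (1 ≤ p)]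
    (h : k + m = n) (ω ω' : Omega D k p) {ψ : E n → Covector n m} (hψ : Continuous ψ)
    (hc : HasCompactSupport ψ) :
    integralTop D (fun x => wedge ((ω + ω' : Omega D k p) x) (ψ x)) =
      integralTop D (fun x => wedge (ω x) (ψ x)) +
        integralTop D (fun x => wedge (ω' x) (ψ x)) := by
  unfold integralTop
  rw [← integral_add (integrable_wedge h ω hψ hc) (integrable_wedge h ω' hψ hc)]
  refine integral_congr_ae ?_
  filter_upwards [Lp.coeFn_add ω ω'] with x hx
  simp only [hx, Pi.add_apply, coeff_univ_wedge h, map_add, ← Finset.sum_add_distrib]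
  exact Finset.sum_congr rfl fun A _ => by ring

lemma integralTop_smul {D : TopologicalSpace.Opens (E n)} {p : ℝ} [Fact (1 ≤ p)]
    (h : k + m = n) (c : ℝ) (ω : Omega D k p) (ψ : E n → Covector n m) :
    integralTop D (fun x => wedge ((c • ω : Omega D k p) x) (ψ x)) =
      c * integralTop D (fun x => wedge (ω x) (ψ x)) := by
  unfold integralTop
  rw [← integral_const_mul]
  refine integral_congr_ae ?_
  filter_upwards [Lp.coeFn_smul c ω] with x hx
  simp only [hx, Pi.smul_apply, coeff_univ_wedge h, map_smul, smul_eq_mul, Finset.mul_sum]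
  exact Finset.sum_congr rfl fun A _ => by ring

variable {D : TopologicalSpace.Opens (E n)} {p : ℝ} [Fact (1 ≤ p)]

lemma integralTop_zero (h : k + m = n) (ψ : E n → Covector n m) :
    integralTop D (fun x => wedge ((0 : Omega D k p) x) (ψ x)) = 0 := by
  have e := integralTop_smul h 0 (0 : Omega D k p) ψ
  rwa [zero_smul, zero_mul] at e

lemma IsWeakDifferential.add {ω ω' : Omega D k p} {η η' : Omega D (k + 1) p}
    (h : IsWeakDifferential D ω η) (h' : IsWeakDifferential D ω' η') :
    IsWeakDifferential D (ω + ω' : Omega D k p) (η + η' : Omega D (k + 1) p) := by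
  intro m hm φ h1 h2 h3
  rw [integralTop_add (by omega) _ _ (extDer_continuous h1) (extDer_hasCompactSupport h2),
    integralTop_add hm _ _ h1.continuous h2, h m hm φ h1 h2 h3, h' m hm φ h1 h2 h3, mul_add]

lemma IsWeakDifferential.smul (c : ℝ) {ω : Omega D k p} {η : Omega D (k + 1) p}
    (h : IsWeakDifferential D ω η) :
    IsWeakDifferential D (c • ω : Omega D k p) (c • η : Omega D (k + 1) p) := by
  intro m hm φ h1 h2 h3
  rw [integralTop_smul (by omega), integralTop_smul hm, h m hm φ h1 h2 h3]
  ring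

lemma isWeakDifferential_zero :
    IsWeakDifferential D (0 : Omega D k p) (0 : Omega D (k + 1) p) := by
  intro m hm φ h1 h2 h3
  rw [integralTop_zero (by omega), integralTop_zero hm, mul_zero]

/-- The distributional differential is unique. -/
lemma IsWeakDifferential.unique {ω : Omega D k p} {η η' : Omega D (k + 1) p}
    (h : IsWeakDifferential D ω η) (h' : IsWeakDifferential D ω η') : η = η' := by
  have h0 : IsWeakDifferential D (0 : Omega D k p) (η - η' : Omega D (k + 1) p) := by
    have := h.add (h'.smul (-1))
    simpa [sub_eq_add_neg] using this
  rw [← sub_eq_zero]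
  set θ : Omega D (k + 1) p := η - η'
  have key : ∀ J : {J : Finset (Fin n) // J.card = k + 1},
      ∀ᵐ x ∂(volume.restrict (D : Set (E n))), θ x J = 0 := by
    intro J
    have h1 : MemLp (fun x => coeff J.1 (θ x)) (ENNReal.ofReal p)
        (volume.restrict (D : Set (E n))) := (coeff J.1).comp_memLp' (Lp.memLp θ)
    have hloc := h1.locallyIntegrable (Fact.out : 1 ≤ ENNReal.ofReal p)
    have := IsOpen.ae_eq_zero_of_integral_contDiff_smul_eq_zero D.isOpen
      (hloc.locallyIntegrableOn D) (fun g hg hgc hgD => ?_)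
    · filter_upwards [this, ae_restrict_mem D.isOpen.measurableSet] with x hx hxD
      rw [← coeff_self]
      exact hx hxD
    have hJ : k + 1 + (J.1ᶜ).card = n := by
      have := Finset.card_add_card_compl J.1
      rw [J.2, Fintype.card_fin] at this
      exact this
    let J' : {I : Finset (Fin n) // I.card = (J.1ᶜ).card} := ⟨J.1ᶜ, rfl⟩
    let φ : E n → Covector n (J.1ᶜ).card := fun x => g x • EuclideanSpace.single J' (1 : ℝ)
    have hφ1 : ContDiff ℝ (⊤ : ℕ∞) φ := hg.smul contDiff_const
    have hφ2 : HasCompactSupport φ := hgc.smul_right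
    have hφ3 : tsupport φ ⊆ D := (tsupport_smul_subset_left g _).trans hgD
    have e := h0 _ hJ φ hφ1 hφ2 hφ3
    rw [integralTop_zero (by omega)] at e
    have e' : integralTop D (fun x => wedge (θ x) (φ x)) = 0 := by
      rcases mul_eq_zero.1 e.symm with h | h
      · exact absurd h (by simp)
      · exact h
    have hw : ∀ x, coeff Finset.univ (wedge (θ x) (φ x)) =
        shuffleSign J.1 J.1ᶜ * (g x • coeff J.1 (θ x)) := by
      intro x
      rw [coeff_univ_wedge hJ, Finset.sum_eq_single J.1]
      · have : coeff J.1ᶜ (φ x) = g x := by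
          rw [coeff_self (φ x) J']; simp [φ]
        rw [this, smul_eq_mul]; ring
      · intro A _ hA
        by_cases hc : Aᶜ.card = (J.1ᶜ).card
        · have : coeff Aᶜ (φ x) = 0 := by
            rw [coeff_self (φ x) ⟨Aᶜ, hc⟩]
            simp [φ, J', hA]
          rw [this, mul_zero]
        · rw [coeff_of_ne hc, mul_zero]
      · simp
    simp only [integralTop, hw, integral_const_mul] at e'
    rcases mul_eq_zero.1 e' with h | h
    · have := shuffleSign_sq J.1 J.1ᶜ
      rw [h] at this
      simp at this
    · exact h
  refine Lp.ext ?_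
  filter_upwards [ae_all_iff.2 key, Lp.coeFn_zero (Covector n (k + 1)) (ENNReal.ofReal p)
    (volume.restrict (D : Set (E n)))] with x hx hx0
  rw [hx0]
  ext J
  exact hx J

end facts

/-- The space `Ω^k_{p,p}(D)` of forms in `Ω^k_p(D)` whose distributional differential is in
`Ω^{k+1}_p(D)`, with the norm of `Ω^k_p(D)`. -/
def OmegaPP {n : ℕ} (D : TopologicalSpace.Opens (E n)) (k : ℕ) (p : ℝ) [Fact (1 ≤ p)] :
    Submodule ℝ (Omega D k p) where
  carrier := {ω | ∃ η : Omega D (k + 1) p, IsWeakDifferential D ω η}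
  add_mem' := fun ⟨η, h⟩ ⟨η', h'⟩ => ⟨η + η', h.add h'⟩
  zero_mem' := ⟨0, isWeakDifferential_zero⟩
  smul_mem' := fun c _ ⟨η, h⟩ => ⟨c • η, h.smul c⟩

/-- The differential `d : Ω^k_{p,p}(D) → Ω^{k+1}_p(D)`. -/
def d {n : ℕ} (D : TopologicalSpace.Opens (E n)) (k : ℕ) (p : ℝ) [Fact (1 ≤ p)] :
    OmegaPP D k p →ₗ[ℝ] Omega D (k + 1) p where
  toFun ω := Classical.choose ω.2
  map_add' ω ω' := (Classical.choose_spec (ω + ω').2).unique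
    ((Classical.choose_spec ω.2).add (Classical.choose_spec ω'.2))
  map_smul' c ω := (Classical.choose_spec (c • ω).2).unique
    ((Classical.choose_spec ω.2).smul c)

lemma isWeakDifferential_d {n k : ℕ} {D : TopologicalSpace.Opens (E n)} {p : ℝ} [Fact (1 ≤ p)]
    (ω : OmegaPP D k p) : IsWeakDifferential D (ω : Omega D k p) (d D k p ω) :=
  Classical.choose_spec ω.2

/-- The space `ℋ^k_p(D) = Ω^k_{p,p}(D) / ker d` of `p`-harmonic `k`-forms. Its norm, supplied by
the general quotient instance, is the quotient norm `‖[ζ]‖ = inf {‖ζ + κ‖ | dκ = 0}`, where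
`‖·‖` is the norm of `Ω^k_p(D)`. -/
abbrev HarmonicSpace {n : ℕ} (D : TopologicalSpace.Opens (E n)) (k : ℕ) (p : ℝ)
    [Fact (1 ≤ p)] : Type :=
  OmegaPP D k p ⧸ LinearMap.ker (d D k p)

/-- The map `ℋ^k_p(D) → Ω^{k+1}_p(D)`, `[ζ] ↦ dζ`, induced by the differential. -/
def dHarmonic {n : ℕ} (D : TopologicalSpace.Opens (E n)) (k : ℕ) (p : ℝ) [Fact (1 ≤ p)] :
    HarmonicSpace D k p →ₗ[ℝ] Omega D (k + 1) p :=
  (LinearMap.ker (d D k p)).liftQ (d D k p) le_rfl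

/-- `U` is `C`-bi-Lipschitz homeomorphic to `V`: there are mutually inverse maps `β : U → V` and
`α : V → U`, where `β` is Lipschitz with constant `C` and `α` with constant `1 / C`. -/
def BiLipschitzHomeomorphic {n : ℕ} (C : ℝ) (U V : Set (E n)) : Prop :=
  ∃ β α : E n → E n, Set.MapsTo β U V ∧ Set.MapsTo α V U ∧ Set.InvOn α β U V ∧
    (∀ x ∈ U, ∀ x' ∈ U, ‖β x - β x'‖ ≤ C * ‖x - x'‖) ∧
    (∀ y ∈ V, ∀ y' ∈ V, ‖α y - α y'‖ ≤ 1 / C * ‖y - y'‖)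

end LpForms

end

noncomputable section

namespace LpForms

/-! ### Exterior algebra in coordinates: signs, interior products and their norms. -/

section algebra

variable {n k m : ℕ}

/-! The Lipschitz constants `C` and `1 / C` are reciprocal, so the maps between `D` and the unit
ball are similarities and `D` is itself a ball of radius `R = 1 / C` about some `w`
(`BiLipschitzHomeomorphic.eq_ball`). On a ball the Poincaré cone operator gives an explicit
primitive of a closed `(k+1)`-form `η`: `K η (x) = ι_{x-w} ∫₀¹ t^k η(w + t(x - w)) dt`. If `η = dζ`,
then `K η` and `ζ` represent the same class, so the class has norm at most `‖K η‖_p`.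

The norm of `K η` is controlled by two estimates: `norm_interior_le`, which costs `√(n choose k) |x
- w|`, and the Hardy-type inequality `lintegral_cone_le`, which costs `(k + 1 - n/p)⁻¹`. The
resulting constant is smaller than the stated one (`cone_constant_le`).

That `d(K η) = η` holds in the distributional sense is proved by duality, without smoothing `η`
(`pairing_interior_cone`). Let `h` be `η` extended by zero, `φ` a test `m`-form and `X = x - w`.
Interior product and dilations are moved onto `φ`, which turns `∫ K h ∧ dφ` into an integral over
`t` of pairings of `h` with dilates of `ι_X dφ`. By Cartan's formula `ι_X dφ = L_X φ - d ι_X φ`. The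
exact term is killed because `h` is closed, and the Lie derivative term is, up to sign, the
`t`-derivative of the pairing of `h` with the pullback of `φ` under the dilation of ratio `1/t`. The
fundamental theorem of calculus leaves the value `∫ h ∧ φ` at `t = 1`; the limit at `t = 0` vanishes
since `k + 1 - n/p > 0`. -/

lemma shuffleSign_eq_prod (A B : Finset (Fin n)) :
    shuffleSign A B = ∏ a ∈ A, ∏ b ∈ B, if b < a then (-1 : ℝ) else 1 := by
  rw [← Finset.prod_product', Finset.prod_ite, shuffleSign]
  simp

lemma shuffleSign_insert_left {i : Fin n} {A : Finset (Fin n)} (h : i ∉ A) (B : Finset (Fin n)) :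
    shuffleSign (insert i A) B = shuffleSign {i} B * shuffleSign A B := by
  simp [shuffleSign_eq_prod, Finset.prod_insert h]

lemma shuffleSign_insert_right {i : Fin n} {B : Finset (Fin n)} (h : i ∉ B)
    (A : Finset (Fin n)) :
    shuffleSign A (insert i B) = shuffleSign A {i} * shuffleSign A B := by
  simp only [shuffleSign_eq_prod, Finset.prod_insert h, Finset.prod_mul_distrib,
    Finset.prod_singleton]

lemma shuffleSign_singleton_mul {i j : Fin n} (h : i ≠ j) :
    shuffleSign {i} {j} * shuffleSign {j} {i} = -1 := by
  rcases lt_or_gt_of_ne h with h | h <;> simp [shuffleSign_eq_prod, h, h.le]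

lemma shuffleSign_mul_swap {i : Fin n} {A : Finset (Fin n)} (h : i ∉ A) :
    shuffleSign A {i} * shuffleSign {i} A = (-1) ^ A.card := by
  simp only [shuffleSign_eq_prod, Finset.prod_singleton, ← Finset.prod_mul_distrib]
  rw [Finset.prod_congr rfl (g := fun _ => (-1 : ℝ)), Finset.prod_const]
  intro a ha
  rcases lt_or_gt_of_ne (show a ≠ i by rintro rfl; exact h ha) with h | h <;> simp [h, h.le]

/-- Moving `i` into and `l` out of an index set in either order gives opposite signs. -/
lemma shuffleSign_exchange {i l : Fin n} {Q : Finset (Fin n)} (hil : i ≠ l) (hi : i ∉ Q)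
    (hl : l ∉ Q) :
    shuffleSign {i} (insert l Q) * shuffleSign {l} (insert i Q) =
      -(shuffleSign {l} Q * shuffleSign {i} Q) := by
  rw [shuffleSign_insert_right hl, shuffleSign_insert_right hi]
  linear_combination shuffleSign {l} Q * shuffleSign {i} Q * shuffleSign_singleton_mul hil

lemma sum_compl_eq_sum_mem (F : Finset (Fin n) → Fin n → ℝ) :
    ∑ A : Finset (Fin n), ∑ i ∈ Aᶜ, F A i = ∑ B : Finset (Fin n), ∑ i ∈ B, F (B.erase i) i := by
  rw [Finset.sum_sigma', Finset.sum_sigma']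
  refine Finset.sum_bij' (fun x _ => ⟨insert x.2 x.1, x.2⟩) (fun x _ => ⟨x.1.erase x.2, x.2⟩)
    ?_ ?_ ?_ ?_ ?_
  · rintro ⟨A, i⟩ h; simp
  · rintro ⟨A, i⟩ h; simp
  · rintro ⟨A, i⟩ h
    have : i ∉ A := by simpa using h
    simp [this]
  · rintro ⟨A, i⟩ h
    have : i ∈ A := by simpa using h
    simp [this]
  · rintro ⟨A, i⟩ h
    have : i ∉ A := by simpa using h
    simp [this]

/-- The interior product of a vector with a covector. -/
def interior (v : E n) (θ : Covector n (k + 1)) : Covector n k :=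
  WithLp.toLp 2 fun J => ∑ i ∈ J.1ᶜ, shuffleSign {i} J.1 * v i * coeff (insert i J.1) θ

/-- Outside the right degree both sides vanish, so later sums may run over all index sets without
tracking cardinalities. `coeff_extDer` serves the same purpose. -/
lemma coeff_interior (v : E n) (θ : Covector n (k + 1)) (J : Finset (Fin n)) :
    coeff J (interior v θ) =
      ∑ i ∈ Jᶜ, shuffleSign {i} J * v i * coeff (insert i J) θ := by
  by_cases hJ : J.card = k
  · exact coeff_self (interior v θ) ⟨J, hJ⟩
  · rw [coeff_of_ne hJ, Finset.sum_eq_zero]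
    intro i hi
    rw [coeff_of_ne, mul_zero]
    rw [Finset.card_insert_of_notMem (by simpa using hi)]
    omega

lemma coeff_extDer (φ : E n → Covector n m) (x : E n) (J : Finset (Fin n)) :
    coeff J (extDer φ x) = ∑ i ∈ J, shuffleSign {i} (J.erase i) *
      fderiv ℝ (fun y => coeff (J.erase i) (φ y)) x (EuclideanSpace.single i 1) := by
  by_cases hJ : J.card = m + 1
  · exact coeff_self (extDer φ x) ⟨J, hJ⟩
  · rw [coeff_of_ne hJ, Finset.sum_eq_zero]
    intro i hi
    have : (fun y => coeff (J.erase i) (φ y)) = fun _ => 0 := by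
      funext y
      rw [coeff_of_ne]
      rw [Finset.card_erase_of_mem hi]
      have := Finset.card_pos.2 ⟨i, hi⟩
      omega
    rw [this]; simp

/-- Each of the `n choose k` coefficients is at most `‖v‖ ‖θ‖` by Cauchy–Schwarz: for fixed `J` the
sets `insert i J` with `i ∉ J` are distinct, so the coefficients of `θ` that occur have square sum
at most `‖θ‖ ^ 2`. -/
lemma norm_interior_le (v : E n) (θ : Covector n (k + 1)) :
    ‖interior v θ‖ ≤ Real.sqrt (n.choose k) * ‖v‖ * ‖θ‖ := by
  have key : ∀ J : {J : Finset (Fin n) // J.card = k},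
      ‖interior v θ J‖ ^ 2 ≤ (‖v‖ * ‖θ‖) ^ 2 := by
    intro J
    have h1 : interior v θ J = ∑ i ∈ J.1ᶜ, v i * (shuffleSign {i} J.1 * coeff (insert i J.1) θ) :=
      Finset.sum_congr rfl fun i _ => by ring
    have h2 : ∑ i ∈ J.1ᶜ, (shuffleSign {i} J.1 * coeff (insert i J.1) θ) ^ 2 ≤ ‖θ‖ ^ 2 := by
      rw [EuclideanSpace.norm_sq_eq]
      have e : ∀ i ∈ J.1ᶜ, (shuffleSign {i} J.1 * coeff (insert i J.1) θ) ^ 2 =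
          coeff (insert i J.1) θ ^ 2 := by
        intro i _
        rw [mul_pow, sq (shuffleSign _ _), shuffleSign_sq, one_mul]
      rw [Finset.sum_congr rfl e]
      have hc : ∀ i ∈ J.1ᶜ, (insert i J.1).card = k + 1 := by
        intro i hi
        rw [Finset.card_insert_of_notMem (by simpa using hi), J.2]
      let g : {i // i ∈ J.1ᶜ} → {B : Finset (Fin n) // B.card = k + 1} :=
        fun i => ⟨insert i.1 J.1, hc i.1 i.2⟩
      have hg : Function.Injective g := fun a b hab =>
        Subtype.ext ((Finset.insert_inj (Finset.mem_compl.1 a.2)).1 (congrArg Subtype.val hab))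
      calc ∑ i ∈ J.1ᶜ, coeff (insert i J.1) θ ^ 2
          = ∑ i ∈ (J.1ᶜ).attach, ‖θ (g i)‖ ^ 2 := by
            rw [← Finset.sum_attach]
            refine Finset.sum_congr rfl fun i _ => ?_
            rw [Real.norm_eq_abs, sq_abs, ← coeff_self]
        _ = ∑ B ∈ (J.1ᶜ).attach.image g, ‖θ B‖ ^ 2 :=
            (Finset.sum_image (f := fun B => ‖θ B‖ ^ 2) fun a _ b _ hab => hg hab).symm
        _ ≤ ∑ B, ‖θ B‖ ^ 2 :=
            Finset.sum_le_sum_of_subset_of_nonneg (Finset.subset_univ _) fun _ _ _ => sq_nonneg _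
    have h3 : ∑ i ∈ J.1ᶜ, v i ^ 2 ≤ ‖v‖ ^ 2 := by
      rw [EuclideanSpace.norm_sq_eq]
      simp only [Real.norm_eq_abs, sq_abs]
      exact Finset.sum_le_sum_of_subset_of_nonneg (Finset.subset_univ _) fun _ _ _ => sq_nonneg _
    rw [Real.norm_eq_abs, sq_abs, h1, mul_pow]
    exact (Finset.sum_mul_sq_le_sq_mul_sq _ _ _).trans
      (mul_le_mul h3 h2 (Finset.sum_nonneg fun _ _ => sq_nonneg _) (sq_nonneg _))
  have hcard : Fintype.card {J : Finset (Fin n) // J.card = k} = n.choose k := by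
    simp
  rw [EuclideanSpace.norm_eq, mul_assoc]
  refine Real.sqrt_le_iff.2 ⟨by positivity, ?_⟩
  rw [mul_pow, Real.sq_sqrt (by positivity), ← hcard]
  simpa using Finset.sum_le_sum fun J (_ : J ∈ Finset.univ) => key J

/-- The form `α ∧ β` has degree `n + 1` and vanishes, so the antiderivation rule for `ι_v` relates
the two terms. In coordinates the terms match under `(A, i) ↦ insert i A`, leaving an identity of
signs. -/
lemma coeff_univ_wedge_interior (h : k + (m + 1) = n) (v : E n) (α : Covector n (k + 1))
    (β : Covector n (m + 1)) :
    coeff Finset.univ (wedge (interior v α) β) =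
      (-1) ^ k * coeff Finset.univ (wedge α (interior v β)) := by
  rw [coeff_univ_wedge h, coeff_univ_wedge (by omega), Finset.mul_sum]
  simp only [coeff_interior, Finset.mul_sum, Finset.sum_mul]
  rw [sum_compl_eq_sum_mem]
  refine Finset.sum_congr rfl fun B _ => ?_
  rw [compl_compl]
  refine Finset.sum_congr rfl fun i hi => ?_
  obtain ⟨A, hA, rfl⟩ : ∃ A, i ∉ A ∧ insert i A = B :=
    ⟨B.erase i, Finset.notMem_erase i B, Finset.insert_erase hi⟩
  rw [Finset.erase_insert hA]
  by_cases hc : A.card = k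
  · have hQ : Aᶜ = insert i (insert i A)ᶜ := by
      ext j; by_cases hj : j = i <;> simp [hj, hA]
    have hiQ : i ∉ (insert i A)ᶜ := by simp
    rw [hQ]
    set Q := (insert i A)ᶜ
    have e1 := shuffleSign_mul_swap hA
    have e2 := shuffleSign_sq {i} Q
    rw [hc] at e1
    rw [shuffleSign_insert_right hiQ, shuffleSign_insert_left hA]
    generalize coeff (insert i A) α = a, coeff (insert i Q) β = b
    linear_combination (shuffleSign A Q * v i * a * b) * e1 -
      ((-1) ^ k * shuffleSign A Q * v i * a * b) * e2
  · have : coeff (insert i A) α = 0 := by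
      apply coeff_of_ne
      rw [Finset.card_insert_of_notMem hA]; omega
    rw [this]; ring

end algebra

/-! ### Exterior calculus of smooth forms: `d² = 0` and Cartan's formula. -/

section calculus

variable {n m : ℕ}

lemma contDiff_coeff {φ : E n → Covector n m} (hφ : ContDiff ℝ (⊤ : ℕ∞) φ)
    (J : Finset (Fin n)) : ContDiff ℝ (⊤ : ℕ∞) fun y => coeff J (φ y) :=
  (coeff J).contDiff.comp hφ

lemma contDiff_of_coeff {φ : E n → Covector n m}
    (h : ∀ J, ContDiff ℝ (⊤ : ℕ∞) fun y => coeff J (φ y)) : ContDiff ℝ (⊤ : ℕ∞) φ := by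
  refine contDiff_euclidean.2 fun J => ?_
  simpa only [coeff_self] using h J.1

lemma contDiff_extDer {φ : E n → Covector n m} (hφ : ContDiff ℝ (⊤ : ℕ∞) φ) :
    ContDiff ℝ (⊤ : ℕ∞) (extDer φ) := by
  refine contDiff_of_coeff fun J => ?_
  simp only [coeff_extDer]
  refine ContDiff.sum fun i _ => contDiff_const.mul ?_
  exact ((contDiff_coeff hφ _).fderiv_right (by simp)).clm_apply contDiff_const

lemma contDiff_interior (w : E n) {φ : E n → Covector n (m + 1)}
    (hφ : ContDiff ℝ (⊤ : ℕ∞) φ) :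
    ContDiff ℝ (⊤ : ℕ∞) fun y => interior (y - w) (φ y) := by
  refine contDiff_of_coeff fun J => ?_
  simp only [coeff_interior, PiLp.sub_apply]
  refine ContDiff.sum fun i _ => (contDiff_const.mul ?_).mul (contDiff_coeff hφ _)
  exact ((EuclideanSpace.proj (𝕜 := ℝ) i).contDiff).sub contDiff_const

lemma extDer_extDer {φ : E n → Covector n m} (hφ : ContDiff ℝ (⊤ : ℕ∞) φ) (x : E n) :
    extDer (extDer φ) x = 0 := by
  have hz : ∀ J, coeff J (extDer (extDer φ) x) = 0 := by
    intro J
    set e : Fin n → E n := fun i => EuclideanSpace.single i 1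
    have hd : ∀ I i, DifferentiableAt ℝ (fun y => fderiv ℝ (fun z => coeff I (φ z)) y (e i)) x :=
      fun I i => (((contDiff_coeff hφ I).fderiv_right (m := (⊤ : ℕ∞)) (by simp)).clm_apply
        contDiff_const).differentiable (by simp) x
    have h1 : coeff J (extDer (extDer φ) x) = ∑ i ∈ J, ∑ l ∈ J.erase i,
        shuffleSign {i} (J.erase i) * shuffleSign {l} ((J.erase i).erase l) *
          fderiv ℝ (fun y => fderiv ℝ (fun z => coeff ((J.erase i).erase l) (φ z)) y (e l)) x
            (e i) := by
      rw [coeff_extDer]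
      refine Finset.sum_congr rfl fun i _ => ?_
      simp only [coeff_extDer]
      rw [fderiv_fun_sum fun l _ => (hd _ l).const_mul _, _root_.sum_apply,
        Finset.mul_sum]
      refine Finset.sum_congr rfl fun l _ => ?_
      rw [fderiv_const_mul (hd _ l), _root_.smul_apply, smul_eq_mul, mul_assoc]
    have hsymm : ∀ I i l, fderiv ℝ (fun y => fderiv ℝ (fun z => coeff I (φ z)) y (e l)) x (e i) =
        fderiv ℝ (fun y => fderiv ℝ (fun z => coeff I (φ z)) y (e i)) x (e l) := by
      intro I i l
      have hf := contDiff_coeff hφ I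
      have hd2 : DifferentiableAt ℝ (fderiv ℝ fun z => coeff I (φ z)) x :=
        (hf.fderiv_right (m := (⊤ : ℕ∞)) (by simp)).differentiable (by simp) x
      rw [fderiv_clm_apply hd2 (differentiableAt_const _),
        fderiv_clm_apply hd2 (differentiableAt_const _)]
      simp only [fderiv_fun_const, Pi.zero_apply, ContinuousLinearMap.comp_zero, zero_add,
        ContinuousLinearMap.flip_apply]
      exact (hf.contDiffAt.isSymmSndFDerivAt (by simpa using WithTop.coe_le_coe.2 (le_top : (2 : ℕ∞) ≤ ⊤))) _ _
    set a : Fin n → Fin n → ℝ := fun i l =>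
        shuffleSign {i} (J.erase i) * shuffleSign {l} ((J.erase i).erase l) *
          fderiv ℝ (fun y => fderiv ℝ (fun z => coeff ((J.erase i).erase l) (φ z)) y (e l)) x
            (e i) with ha
    -- Second derivatives are symmetric while removing `i` and `l` in the two orders gives opposite
    -- signs, so the double sum equals its own negative.
    have hanti : ∀ i ∈ J, ∀ l ∈ J.erase i, a i l = -a l i := by
      intro i hi l hl
      have hl' : l ≠ i ∧ l ∈ J := by simpa using hl
      simp only [ha]
      rw [Finset.erase_right_comm (a := l) (b := i), hsymm]
      have hQi : i ∉ (J.erase i).erase l := by simp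
      have hQl : l ∉ (J.erase i).erase l := by simp
      have e1 : J.erase i = insert l ((J.erase i).erase l) := (Finset.insert_erase hl).symm
      have e2 : J.erase l = insert i ((J.erase i).erase l) := by
        rw [Finset.erase_right_comm, Finset.insert_erase]; simp [hi, hl'.1.symm]
      have := shuffleSign_exchange hl'.1.symm hQi hQl
      rw [← e1, ← e2] at this
      generalize fderiv ℝ (fun y => fderiv ℝ (fun z => coeff ((J.erase i).erase l) (φ z)) y (e i)) x
            (e l) = D
      set Q := (J.erase i).erase l
      have e3 := shuffleSign_sq {l} Q
      have e4 := shuffleSign_sq {i} Q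
      have e5 := shuffleSign_sq {l} (J.erase l)
      linear_combination D * shuffleSign {l} Q * shuffleSign {l} (J.erase l) * this
        - D * shuffleSign {i} (J.erase i) * shuffleSign {l} Q * e5
        - D * shuffleSign {i} Q * shuffleSign {l} (J.erase l) * e3
    have h2 : ∑ i ∈ J, ∑ l ∈ J.erase i, a i l = ∑ i ∈ J, ∑ l ∈ J.erase i, a l i := by
      refine Finset.sum_comm' fun i l => ?_
      simp only [Finset.mem_erase]; tauto
    have h3 : ∑ i ∈ J, ∑ l ∈ J.erase i, a i l = -∑ i ∈ J, ∑ l ∈ J.erase i, a l i := by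
      simp only [← Finset.sum_neg_distrib]
      exact Finset.sum_congr rfl fun i hi => Finset.sum_congr rfl fun l hl => hanti i hi l hl
    rw [h1]
    linarith
  ext J
  rw [← coeff_self, hz]; simp

/-- Cartan's formula for the Lie derivative along the radial field `x - w`, by coefficients. -/
lemma coeff_interior_extDer {φ : E n → Covector n m} (hφ : ContDiff ℝ (⊤ : ℕ∞) φ) (w x : E n)
    {J : Finset (Fin n)} (hJ : J.card = m) :
    coeff J (interior (x - w) (extDer φ x)) =
      m * coeff J (φ x) + fderiv ℝ (fun y => coeff J (φ y)) x (x - w) -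
        ∑ l ∈ J, shuffleSign {l} (J.erase l) *
          fderiv ℝ (fun y => ∑ i ∈ (J.erase l)ᶜ, shuffleSign {i} (J.erase l) * (y - w) i *
            coeff (insert i (J.erase l)) (φ y)) x (EuclideanSpace.single l 1) := by
  set e : Fin n → E n := fun i => EuclideanSpace.single i 1 with he
  set P : Finset (Fin n) → Fin n → ℝ := fun I i => fderiv ℝ (fun y => coeff I (φ y)) x (e i)
    with h_partial
  have hd : ∀ I, DifferentiableAt ℝ (fun y => coeff I (φ y)) x :=
    fun I => (contDiff_coeff hφ I).differentiable (by simp) x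
  have hX : ∀ i, HasFDerivAt (fun y : E n => (y - w) i) (EuclideanSpace.proj (𝕜 := ℝ) i) x := by
    intro i
    simpa using ((EuclideanSpace.proj (𝕜 := ℝ) i).hasFDerivAt (x := x)).sub_const (w i)
  have hprod : ∀ l ∈ J, fderiv ℝ (fun y => ∑ i ∈ (J.erase l)ᶜ, shuffleSign {i} (J.erase l) *
      (y - w) i * coeff (insert i (J.erase l)) (φ y)) x (e l) =
      shuffleSign {l} (J.erase l) * (coeff J (φ x) + (x - w) l * P J l) +
        ∑ i ∈ Jᶜ, shuffleSign {i} (J.erase l) * (x - w) i * P (insert i (J.erase l)) l := by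
    intro l hl
    have h1 : ∀ i, HasFDerivAt (fun y => shuffleSign {i} (J.erase l) *
        (y - w) i * coeff (insert i (J.erase l)) (φ y)) _ x :=
      fun i => ((hX i).const_mul (shuffleSign {i} (J.erase l))).mul (hd _).hasFDerivAt
    rw [(HasFDerivAt.fun_sum fun i _ => h1 i).fderiv, _root_.sum_apply]
    have hc : (J.erase l)ᶜ = insert l Jᶜ := by
      ext j; by_cases hj : j = l <;> simp [hj]
    rw [hc, Finset.sum_insert (by simpa using hl)]
    congr 1
    · simp [h_partial, he, Finset.insert_erase hl]; ring
    · refine Finset.sum_congr rfl fun i hi => ?_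
      have : i ≠ l := by rintro rfl; simp [hl] at hi
      simp [h_partial, he, this]
  have hL : coeff J (interior (x - w) (extDer φ x)) =
      ∑ i ∈ Jᶜ, ((x - w) i * P J i + ∑ l ∈ J, shuffleSign {i} J * (x - w) i *
        (shuffleSign {l} (insert i (J.erase l)) * P (insert i (J.erase l)) l)) := by
    rw [coeff_interior]
    refine Finset.sum_congr rfl fun i hi => ?_
    have hi' : i ∉ J := by simpa using hi
    rw [coeff_extDer, Finset.sum_insert hi', Finset.erase_insert hi', mul_add, Finset.mul_sum]
    congr 1
    · linear_combination ((x - w) i * P J i) * shuffleSign_sq {i} J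
    · refine Finset.sum_congr rfl fun l hl => ?_
      have : i ≠ l := by rintro rfl; exact hi' hl
      rw [Finset.erase_insert_of_ne this]
  have hE : fderiv ℝ (fun y => coeff J (φ y)) x (x - w) = ∑ i, (x - w) i * P J i := by
    have : x - w = ∑ i, (x - w) i • e i := by
      ext j; simp [he, Pi.single_apply]
    conv_lhs => rw [this]
    simp [h_partial]
  -- The terms with `i = l` in `d ι_X φ` give `m φ_J` and the derivatives along `X` in directions of
  -- `J`; those in directions outside `J` come from `ι_X dφ`. The mixed terms cancel by
  -- `shuffleSign_exchange`.
  rw [hL, hE, Finset.sum_congr rfl fun l hl => congrArg (shuffleSign {l} (J.erase l) * ·)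
    (hprod l hl), Finset.sum_add_distrib]
  have hsplit := Finset.sum_add_sum_compl J fun i => (x - w) i * P J i
  have hdiag : ∑ l ∈ J, shuffleSign {l} (J.erase l) *
      (shuffleSign {l} (J.erase l) * (coeff J (φ x) + (x - w) l * P J l)) =
      m * coeff J (φ x) + ∑ l ∈ J, (x - w) l * P J l := by
    rw [Finset.sum_congr rfl (g := fun l => coeff J (φ x) + (x - w) l * P J l)
      fun l _ => by rw [← mul_assoc, shuffleSign_sq, one_mul], Finset.sum_add_distrib]
    simp [hJ]
  have hcross : ∑ i ∈ Jᶜ, ∑ l ∈ J, shuffleSign {i} J * (x - w) i *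
        (shuffleSign {l} (insert i (J.erase l)) * P (insert i (J.erase l)) l) =
      -∑ l ∈ J, shuffleSign {l} (J.erase l) *
        ∑ i ∈ Jᶜ, shuffleSign {i} (J.erase l) * (x - w) i * P (insert i (J.erase l)) l := by
    rw [Finset.sum_comm, ← Finset.sum_neg_distrib]
    refine Finset.sum_congr rfl fun l hl => ?_
    rw [Finset.mul_sum, ← Finset.sum_neg_distrib]
    refine Finset.sum_congr rfl fun i hi => ?_
    have hi' : i ∉ J := by simpa using hi
    have hil : i ≠ l := by rintro rfl; exact hi' hl
    have := shuffleSign_exchange hil (Q := J.erase l) (by simp [hi']) (by simp)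
    rw [Finset.insert_erase hl] at this
    linear_combination ((x - w) i * P (insert i (J.erase l)) l) * this
  simp only [mul_add, Finset.sum_add_distrib] at hdiag ⊢
  rw [hcross]
  linarith

end calculus

/-! ### Rigidity of the bi-Lipschitz hypothesis. -/

/-- The two Lipschitz bounds together force `C ‖α y - α y'‖ = ‖y - y'‖`. After rescaling and
recentring, `α` becomes a norm- and distance-preserving map `Γ` of the unit ball fixing `0`, hence
preserves inner products by polarization. It is therefore the restriction of a linear isometry, and
its image is the whole unit ball. -/
lemma BiLipschitzHomeomorphic.eq_ball {n : ℕ} {C : ℝ} (hC : 0 < C) {U : Set (E n)} {z : E n}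
    (h : BiLipschitzHomeomorphic C U (Metric.ball z 1)) : ∃ w, U = Metric.ball w (1 / C) := by
  obtain ⟨β, α, hβ, hα, hinv, h1, h2⟩ := h
  have hdist : ∀ y ∈ Metric.ball z 1, ∀ y' ∈ Metric.ball z 1,
      C * ‖α y - α y'‖ = ‖y - y'‖ := by
    intro y hy y' hy'
    refine le_antisymm ?_ ?_
    · calc C * ‖α y - α y'‖ ≤ C * (1 / C * ‖y - y'‖) := by gcongr; exact h2 y hy y' hy'
        _ = ‖y - y'‖ := by field_simp
    · simpa only [hinv.2 hy, hinv.2 hy'] using h1 _ (hα hy) _ (hα hy')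
  have hz : z ∈ Metric.ball z 1 := by simp
  set Γ : E n → E n := fun u => C • (α (z + u) - α z) with hΓ
  have hmem : ∀ u : E n, ‖u‖ < 1 → z + u ∈ Metric.ball z 1 := fun u hu => by
    simpa [dist_eq_norm] using hu
  have hnorm : ∀ u, ‖u‖ < 1 → ‖Γ u‖ = ‖u‖ := fun u hu => by
    rw [hΓ]
    simp only [norm_smul, Real.norm_eq_abs, abs_of_pos hC]
    rw [hdist _ (hmem u hu) _ hz, add_sub_cancel_left]
  have hinner : ∀ u v, ‖u‖ < 1 → ‖v‖ < 1 → inner ℝ (Γ u) (Γ v) = inner ℝ u v := by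
    intro u v hu hv
    have e : ‖Γ u - Γ v‖ = ‖u - v‖ := by
      rw [hΓ]
      simp only [← smul_sub, sub_sub_sub_cancel_right, norm_smul, Real.norm_eq_abs,
        abs_of_pos hC]
      rw [hdist _ (hmem u hu) _ (hmem v hv), add_sub_add_left_eq_sub]
    rw [real_inner_eq_norm_mul_self_add_norm_mul_self_sub_norm_sub_mul_self_div_two,
      real_inner_eq_norm_mul_self_add_norm_mul_self_sub_norm_sub_mul_self_div_two, e,
      hnorm u hu, hnorm v hv]
  -- Half basis vectors, because `Γ` is controlled only on the open unit ball; the factor `2` is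
  -- restored afterwards.
  set e : Fin n → E n := fun i => EuclideanSpace.single i (1 / 2) with he
  have he1 : ∀ i, ‖e i‖ < 1 := fun i => by simp [he]; norm_num
  have hon : Orthonormal ℝ fun i => (2 : ℝ) • Γ (e i) := by
    rw [orthonormal_iff_ite]
    intro i j
    rw [inner_smul_left, inner_smul_right, hinner _ _ (he1 i) (he1 j)]
    by_cases hij : i = j
    · subst hij; simp [he]; norm_num
    · simp [he, EuclideanSpace.inner_single_left, hij]
  set b := OrthonormalBasis.mk hon
    (hon.linearIndependent.span_eq_top_of_card_eq_finrank' (by simp)).ge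
  have hb : ∀ i, b i = (2 : ℝ) • Γ (e i) := fun i => by simp [b]
  refine ⟨α z, Set.Subset.antisymm ?_ ?_⟩
  · intro x hx
    have h3 := hdist _ (hβ hx) _ hz
    have h4 : ‖β x - z‖ < 1 := by simpa [dist_eq_norm] using hβ hx
    rw [← h3, hinv.1 hx] at h4
    rw [Metric.mem_ball, dist_eq_norm, lt_div_iff₀ hC]
    linarith
  · intro x hx
    set v := C • (x - α z) with hv
    have hv1 : ‖v‖ < 1 := by
      rw [Metric.mem_ball, dist_eq_norm, lt_div_iff₀ hC] at hx
      rw [hv, norm_smul, Real.norm_eq_abs, abs_of_pos hC]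
      linarith
    -- The preimage of `v` is its coordinate vector in the basis `2 Γ(e i)`, since `Γ` preserves
    -- inner products.
    set u : E n := b.repr v with hu
    have hu1 : ‖u‖ < 1 := by rwa [hu, b.repr.norm_map]
    have hΓu : Γ u = v := by
      apply b.repr.injective
      ext i
      rw [b.repr_apply_apply, hb, inner_smul_left, hinner _ _ (he1 i) hu1]
      simp [he, EuclideanSpace.inner_single_left, ← hu]
    have hx' : α (z + u) = x := by
      have := smul_right_injective (E n) hC.ne' (hΓu : C • (α (z + u) - α z) = C • (x - α z))
      simpa using this
    rw [← hx']
    exact hα (hmem u hu1)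

/-! ### Dilations and the Hardy-type inequality. -/

section dilation

variable {n : ℕ}

/-- The dilation of ratio `t` about `w`. -/
def dil (w : E n) (t : ℝ) (x : E n) : E n := w + t • (x - w)

lemma continuous_dil (w : E n) : Continuous fun q : ℝ × E n => dil w q.1 q.2 := by
  unfold dil; fun_prop

lemma continuous_dil_right (w : E n) (t : ℝ) : Continuous (dil w t) := by
  unfold dil; fun_prop

lemma contDiff_dil (w : E n) (t : ℝ) : ContDiff ℝ (⊤ : ℕ∞) (dil w t) := by
  unfold dil; fun_prop

@[simp] lemma dil_one (w x : E n) : dil w 1 x = x := by simp [dil]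

lemma dil_dil_inv (w : E n) {t : ℝ} (ht : t ≠ 0) (x : E n) : dil w t⁻¹ (dil w t x) = x := by
  simp [dil, smul_smul, ht]

lemma dil_inv_dil (w : E n) {t : ℝ} (ht : t ≠ 0) (x : E n) : dil w t (dil w t⁻¹ x) = x := by
  simp [dil, smul_smul, ht]

/-- The dilation as a homeomorphism. -/
def dilHomeo (w : E n) {t : ℝ} (ht : t ≠ 0) : E n ≃ₜ E n where
  toFun := dil w t
  invFun := dil w t⁻¹
  left_inv := dil_dil_inv w ht
  right_inv := dil_inv_dil w ht
  continuous_toFun := continuous_dil_right w t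
  continuous_invFun := continuous_dil_right w t⁻¹

lemma map_dil (w : E n) {t : ℝ} (ht : 0 < t) :
    Measure.map (dil w t) volume = ENNReal.ofReal ((t ^ n)⁻¹) • (volume : Measure (E n)) := by
  have h1 : dil w t = (fun y => w + y) ∘ (fun y => t • y) ∘ fun x => x - w := rfl
  rw [h1, ← Measure.map_map (by fun_prop) (by fun_prop), ← Measure.map_map (by fun_prop)
    (by fun_prop), (measurePreserving_sub_right volume w).map_eq,
    Measure.map_addHaar_smul _ ht.ne', Measure.map_smul,
    (measurePreserving_add_left volume w).map_eq]
  simp [abs_of_pos ht]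

lemma lintegral_comp_dil (w : E n) {t : ℝ} (ht : 0 < t) (u : E n → ℝ≥0∞) :
    ∫⁻ x, u (dil w t x) = ENNReal.ofReal ((t ^ n)⁻¹) * ∫⁻ x, u x := by
  have := lintegral_map_equiv (μ := volume) u (dilHomeo w ht.ne').toMeasurableEquiv
  have h2 : ⇑(dilHomeo w ht.ne').toMeasurableEquiv = dil w t := rfl
  rw [h2, map_dil w ht, lintegral_smul_measure] at this
  exact this.symm

lemma integral_comp_dil (w : E n) {t : ℝ} (ht : 0 < t) (f : E n → ℝ) :
    ∫ x, f (dil w t x) = (t ^ n)⁻¹ * ∫ x, f x := by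
  have := integral_map_equiv (μ := volume) (dilHomeo w ht.ne').toMeasurableEquiv f
  have h2 : ⇑(dilHomeo w ht.ne').toMeasurableEquiv = dil w t := rfl
  rw [h2, map_dil w ht, integral_smul_measure, ENNReal.toReal_ofReal (by positivity)] at this
  exact this.symm

lemma lintegral_rpow_Ioo {b : ℝ} (hb : -1 < b) :
    ∫⁻ t in Set.Ioo (0 : ℝ) 1, ENNReal.ofReal (t ^ b) = ENNReal.ofReal ((b + 1)⁻¹) := by
  have h1 : IntegrableOn (fun t : ℝ => t ^ b) (Set.Ioo 0 1) := by
    have := (intervalIntegral.intervalIntegrable_rpow' (a := 0) (b := 1) hb).1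
    exact this.mono_set Set.Ioo_subset_Ioc_self
  rw [← ofReal_integral_eq_lintegral_ofReal h1, ← integral_Ioc_eq_integral_Ioo,
    ← intervalIntegral.integral_of_le zero_le_one, integral_rpow (Or.inl hb),
    Real.one_rpow, Real.zero_rpow (by linarith), sub_zero, one_div]
  exact (ae_restrict_mem measurableSet_Ioo).mono fun t ht => Real.rpow_nonneg ht.1.le _

/-- The Hardy-type inequality `‖∫₀¹ t^k u(w + t(x - w)) dt‖_p ≤ (k + 1 - n/p)⁻¹ ‖u‖_p`. -/
lemma lintegral_cone_le (w : E n) (k : ℕ) {p : ℝ} (hp : 1 ≤ p) (hb : 0 < k + 1 - n / p)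
    {u : E n → ℝ≥0∞} (hu : Measurable u) :
    ∫⁻ x, (∫⁻ t in Set.Ioo (0 : ℝ) 1, ENNReal.ofReal (t ^ k) * u (dil w t x)) ^ p ≤
      ENNReal.ofReal ((k + 1 - n / p)⁻¹) ^ p * ∫⁻ x, u x ^ p := by
  have hp0 : 0 < p := by linarith
  -- Write `t^k = t^b t^(n/p)` and apply Jensen's inequality for the measure `t^b dt` on `(0, 1)`,
  -- whose mass is `c = (b + 1)⁻¹`. This gives the factor `c^(p-1)`.
  set b : ℝ := k - n / p with hbdef
  have hb1 : -1 < b := by rw [hbdef]; linarith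
  set c : ℝ≥0∞ := ENNReal.ofReal ((k + 1 - n / p)⁻¹) with hc
  have hmeas : Measurable fun q : E n × ℝ => u (dil w q.2 q.1) :=
    hu.comp ((continuous_dil w).comp continuous_swap).measurable
  have hw : Measurable fun t : ℝ => ENNReal.ofReal (t ^ b) := by fun_prop
  set ν := (volume.restrict (Set.Ioo (0 : ℝ) 1)).withDensity fun t => ENNReal.ofReal (t ^ b)
    with hν
  have hmass : ν Set.univ = c := by
    rw [hν, withDensity_apply _ MeasurableSet.univ, Measure.restrict_univ,
      lintegral_rpow_Ioo hb1, hc, hbdef]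
    ring_nf
  have hc0 : c ≠ 0 := by simpa [hc] using hb
  have hct : c ≠ ∞ := ENNReal.ofReal_ne_top
  have jensen : ∀ f : ℝ → ℝ≥0∞, Measurable f → (∫⁻ t, f t ∂ν) ^ p ≤
      c ^ (p - 1) * ∫⁻ t, f t ^ p ∂ν := by
    intro f hf
    have h := eLpNorm'_le_eLpNorm'_mul_rpow_measure_univ (μ := ν) one_pos hp
      hf.aestronglyMeasurable
    simp only [eLpNorm'_eq_lintegral_enorm, enorm_eq_self, ENNReal.rpow_one, div_one, hmass] at h
    calc (∫⁻ t, f t ∂ν) ^ p ≤ ((∫⁻ t, f t ^ p ∂ν) ^ (1 / p) * c ^ (1 - 1 / p)) ^ p := by gcongr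
      _ = c ^ (p - 1) * ∫⁻ t, f t ^ p ∂ν := by
        rw [ENNReal.mul_rpow_of_nonneg _ _ hp0.le, ← ENNReal.rpow_mul, ← ENNReal.rpow_mul,
          one_div_mul_cancel hp0.ne', ENNReal.rpow_one, mul_comm]
        congr 2; field_simp
  have hpt : ∀ x, (∫⁻ t in Set.Ioo (0 : ℝ) 1, ENNReal.ofReal (t ^ k) * u (dil w t x)) ^ p ≤
      c ^ (p - 1) * ∫⁻ t in Set.Ioo (0 : ℝ) 1,
        ENNReal.ofReal (t ^ b) * (ENNReal.ofReal (t ^ n) * u (dil w t x) ^ p) := by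
    intro x
    have hux : Measurable fun t : ℝ => u (dil w t x) :=
      hmeas.comp (measurable_const.prodMk measurable_id)
    set f : ℝ → ℝ≥0∞ := fun t => ENNReal.ofReal (t ^ (n / p)) * u (dil w t x) with hf
    have hfm : Measurable f := by
      have : Measurable fun t : ℝ => ENNReal.ofReal (t ^ (n / p)) := by fun_prop
      exact this.mul hux
    have h := jensen f hfm
    rw [hν, lintegral_withDensity_eq_lintegral_mul _ hw hfm,
      lintegral_withDensity_eq_lintegral_mul _ hw (hfm.pow_const p)] at h
    refine le_trans (le_of_eq ?_) (h.trans (le_of_eq ?_))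
    · congr 1
      refine setLIntegral_congr_fun measurableSet_Ioo fun t ht => ?_
      simp only [Pi.mul_apply, hf]
      rw [← mul_assoc, ← ENNReal.ofReal_mul (Real.rpow_nonneg ht.1.le _), ← Real.rpow_add ht.1,
        hbdef, sub_add_cancel, Real.rpow_natCast]
    · congr 1
      refine setLIntegral_congr_fun measurableSet_Ioo fun t ht => ?_
      simp only [Pi.mul_apply, hf]
      rw [ENNReal.mul_rpow_of_nonneg _ _ hp0.le, ENNReal.ofReal_rpow_of_nonneg
        (Real.rpow_nonneg ht.1.le _) hp0.le, ← Real.rpow_mul ht.1.le, div_mul_cancel₀ _ hp0.ne',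
        Real.rpow_natCast]
  calc ∫⁻ x, (∫⁻ t in Set.Ioo (0 : ℝ) 1, ENNReal.ofReal (t ^ k) * u (dil w t x)) ^ p
      ≤ ∫⁻ x, c ^ (p - 1) * ∫⁻ t in Set.Ioo (0 : ℝ) 1,
        ENNReal.ofReal (t ^ b) * (ENNReal.ofReal (t ^ n) * u (dil w t x) ^ p) :=
        lintegral_mono hpt
    _ = c ^ (p - 1) * ∫⁻ x, ∫⁻ t in Set.Ioo (0 : ℝ) 1,
        ENNReal.ofReal (t ^ b) * (ENNReal.ofReal (t ^ n) * u (dil w t x) ^ p) :=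
        lintegral_const_mul' _ _ (ENNReal.rpow_ne_top_of_nonneg (by linarith) hct)
    _ = c ^ (p - 1) * ∫⁻ t in Set.Ioo (0 : ℝ) 1, ∫⁻ x,
        ENNReal.ofReal (t ^ b) * (ENNReal.ofReal (t ^ n) * u (dil w t x) ^ p) := by
        rw [lintegral_lintegral_swap]
        refine Measurable.aemeasurable ?_
        have e1 : Measurable fun q : E n × ℝ => ENNReal.ofReal (q.2 ^ b) := hw.comp measurable_snd
        have e2 : Measurable fun q : E n × ℝ => ENNReal.ofReal (q.2 ^ n) := by fun_prop
        exact e1.mul (e2.mul (hmeas.pow_const p))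
    _ = c ^ (p - 1) * ∫⁻ t in Set.Ioo (0 : ℝ) 1, ENNReal.ofReal (t ^ b) * ∫⁻ x, u x ^ p := by
        congr 1
        refine setLIntegral_congr_fun measurableSet_Ioo fun t ht => ?_
        -- The `p`-th power of `t^(n/p)` cancels the Jacobian `t^(-n)` exactly, so the inner
        -- integral no longer depends on `t`; the remaining `∫ t^b dt` supplies the last factor `c`.
        rw [lintegral_const_mul' _ _ ENNReal.ofReal_ne_top,
          lintegral_const_mul' _ _ ENNReal.ofReal_ne_top,
          lintegral_comp_dil w ht.1 fun x => u x ^ p, ← mul_assoc (ENNReal.ofReal (t ^ n)),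
          ← ENNReal.ofReal_mul (pow_nonneg ht.1.le _), mul_inv_cancel₀ (pow_pos ht.1 n).ne',
          ENNReal.ofReal_one, one_mul]
    _ = c ^ p * ∫⁻ x, u x ^ p := by
        rw [lintegral_mul_const _ hw, lintegral_rpow_Ioo hb1, ← mul_assoc]
        have : ENNReal.ofReal ((b + 1)⁻¹) = c ^ (1 : ℝ) := by
          rw [ENNReal.rpow_one, hc, hbdef]; ring_nf
        rw [this, ← ENNReal.rpow_add _ _ hc0 hct, sub_add_cancel]

end dilation

/-! ### Scalar integrals along dilations. -/

section scalar

variable {n : ℕ}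

/-- Differentiation under the integral. Writing `y - w = s⁻¹ (dil w s y - w)` expresses the
derivative through `x ↦ Dg(x)(x - w)`, which is continuous with compact support, so `|f|` times a
constant dominates for parameters above `s / 2`. -/
lemma hasDerivAt_integral_mul_dil (w : E n) {f : E n → ℝ} (hf : Integrable f) {g : E n → ℝ}
    (hg : ContDiff ℝ (⊤ : ℕ∞) g) (hc : HasCompactSupport g) {s : ℝ} (hs : 0 < s) :
    HasDerivAt (fun s => ∫ y, f y * g (dil w s y))
      (s⁻¹ * ∫ y, f y * fderiv ℝ g (dil w s y) (dil w s y - w)) s := by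
  have hX : Continuous fun x => fderiv ℝ g x (x - w) :=
    (hg.continuous_fderiv (by simp)).clm_apply (by fun_prop)
  have hXc : HasCompactSupport fun x => fderiv ℝ g x (x - w) := by
    refine HasCompactSupport.intro (K := tsupport (fderiv ℝ g)) (hc.fderiv ℝ) fun x hx => ?_
    rw [image_eq_zero_of_notMem_tsupport hx]; simp
  obtain ⟨M, hM⟩ := hX.bounded_above_of_compact_support hXc
  obtain ⟨N, hN⟩ := hg.continuous.bounded_above_of_compact_support hc
  have hmeas : ∀ r, AEStronglyMeasurable (fun y => f y * g (dil w r y)) volume := fun r =>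
    hf.aestronglyMeasurable.mul
      (hg.continuous.comp (continuous_dil_right w r)).aestronglyMeasurable
  have hXs : Continuous fun y => fderiv ℝ g (dil w s y) (dil w s y - w) :=
    hX.comp (continuous_dil_right w s)
  have key := hasDerivAt_integral_of_dominated_loc_of_deriv_le (μ := volume) (x₀ := s)
    (F := fun r y => f y * g (dil w r y))
    (F' := fun r y => f y * (r⁻¹ * fderiv ℝ g (dil w r y) (dil w r y - w)))
    (bound := fun y => ‖f y‖ * ((s / 2)⁻¹ * M)) (Ioi_mem_nhds (half_lt_self hs))
    (Filter.Eventually.of_forall hmeas)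
    (hf.mul_bdd (hg.continuous.comp (continuous_dil_right w s)).aestronglyMeasurable
      (Filter.Eventually.of_forall fun y => hN _))
    (hf.aestronglyMeasurable.mul (continuous_const.mul hXs).aestronglyMeasurable) ?_
    (hf.norm.mul_const _) ?_
  · have e : s⁻¹ * ∫ y, f y * fderiv ℝ g (dil w s y) (dil w s y - w) =
        ∫ y, f y * (s⁻¹ * fderiv ℝ g (dil w s y) (dil w s y - w)) := by
      rw [← integral_const_mul]
      exact integral_congr_ae (Filter.Eventually.of_forall fun y => by ring)
    rw [e]
    exact key.2
  · refine Filter.Eventually.of_forall fun y r hr => ?_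
    have hr' : s / 2 < r := hr
    rw [norm_mul, norm_mul, norm_inv, Real.norm_of_nonneg (by linarith : (0 : ℝ) ≤ r)]
    gcongr
    exact hM _
  · refine Filter.Eventually.of_forall fun y r hr => ?_
    have hr' : 0 < r := (half_pos hs).trans hr
    have hd : HasDerivAt (fun r => dil w r y) (y - w) r := by
      simpa [dil] using ((hasDerivAt_id r).smul_const (y - w)).const_add w
    have hg' := (hg.differentiable (by simp) (dil w r y)).hasFDerivAt.comp_hasDerivAt r hd
    have e : dil w r y - w = r • (y - w) := by simp [dil]
    rw [e, map_smul, smul_eq_mul, inv_mul_cancel_left₀ hr'.ne']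
    exact hg'.const_mul (f y)

lemma integral_dil_mul (w : E n) (f g : E n → ℝ) {t : ℝ} (ht : 0 < t) :
    ∫ x, f (dil w t x) * g x = (t ^ n)⁻¹ * ∫ y, f y * g (dil w t⁻¹ y) := by
  rw [← integral_comp_dil w ht fun y => f y * g (dil w t⁻¹ y)]
  simp only [dil_dil_inv w ht.ne']

variable {p : ℝ}

lemma lintegral_cone_lt_top (w : E n) (k : ℕ) (hp : 1 ≤ p) (hb : 0 < k + 1 - n / p)
    {F : Type*} [NormedAddCommGroup F] {f : E n → F} (hfm : StronglyMeasurable f)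
    (hf : MemLp f (ENNReal.ofReal p)) :
    ∫⁻ x, (∫⁻ t in Set.Ioo (0 : ℝ) 1, ENNReal.ofReal (t ^ k) * ‖f (dil w t x)‖ₑ) ^ p < ∞ := by
  have hp0 : 0 < p := by linarith
  refine (lintegral_cone_le w k hp hb hfm.enorm).trans_lt (ENNReal.mul_lt_top
    (ENNReal.rpow_lt_top_of_nonneg hp0.le ENNReal.ofReal_ne_top) ?_)
  have := lintegral_rpow_enorm_lt_top_of_eLpNorm_lt_top (by simpa using hp0)
    ENNReal.ofReal_ne_top hf.2
  rwa [ENNReal.toReal_ofReal hp0.le] at this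

lemma enorm_pow_smul_of_mem {F : Type*} [NormedAddCommGroup F] [NormedSpace ℝ F] (k : ℕ) {t : ℝ}
    (ht : t ∈ Set.Ioo (0 : ℝ) 1) (v : F) : ‖t ^ k • v‖ₑ = ENNReal.ofReal (t ^ k) * ‖v‖ₑ := by
  rw [enorm_smul, Real.enorm_of_nonneg (pow_nonneg ht.1.le _)]

lemma stronglyMeasurable_pow_smul_dil (w : E n) (k : ℕ) {F : Type*} [NormedAddCommGroup F]
    [NormedSpace ℝ F] {f : E n → F} (hfm : StronglyMeasurable f) :
    StronglyMeasurable (Function.uncurry fun (x : E n) (t : ℝ) => t ^ k • f (dil w t x)) := by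
  have h1 : StronglyMeasurable fun q : E n × ℝ => q.2 ^ k :=
    (continuous_snd.pow k).stronglyMeasurable
  exact h1.smul (hfm.comp_measurable ((continuous_dil w).comp continuous_swap).measurable)

lemma ae_integrable_cone (w : E n) (k : ℕ) (hp : 1 ≤ p) (hb : 0 < k + 1 - n / p)
    {F : Type*} [NormedAddCommGroup F] [NormedSpace ℝ F] {f : E n → F}
    (hfm : StronglyMeasurable f) (hf : MemLp f (ENNReal.ofReal p)) :
    ∀ᵐ x, Integrable (fun t => t ^ k • f (dil w t x)) (volume.restrict (Set.Ioo 0 1)) := by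
  have hp0 : 0 < p := by linarith
  have h1 : Measurable fun x => ∫⁻ t in Set.Ioo (0 : ℝ) 1, ‖t ^ k • f (dil w t x)‖ₑ :=
    (stronglyMeasurable_pow_smul_dil w k hfm).enorm.lintegral_prod_right'
  have h2 : ∀ x, ∫⁻ t in Set.Ioo (0 : ℝ) 1, ‖t ^ k • f (dil w t x)‖ₑ =
      ∫⁻ t in Set.Ioo (0 : ℝ) 1, ENNReal.ofReal (t ^ k) * ‖f (dil w t x)‖ₑ := fun x =>
    setLIntegral_congr_fun measurableSet_Ioo fun t ht => enorm_pow_smul_of_mem k ht _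
  have h3 := lintegral_cone_lt_top w k hp hb hfm hf
  simp only [← h2] at h3
  filter_upwards [ae_lt_top (h1.pow_const p) h3.ne] with x hx
  refine ⟨((stronglyMeasurable_pow_smul_dil w k hfm).comp_measurable
    (measurable_const.prodMk measurable_id)).aestronglyMeasurable, ?_⟩
  rw [hasFiniteIntegral_iff_enorm]
  by_contra hcon
  rw [not_lt, top_le_iff] at hcon
  rw [hcon, ENNReal.top_rpow_of_pos hp0] at hx
  exact lt_irrefl _ hx

lemma integrable_cone_mul (w : E n) (k : ℕ) (hp : 1 ≤ p) (hb : 0 < k + 1 - n / p)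
    {f : E n → ℝ} (hfm : StronglyMeasurable f) (hf : MemLp f (ENNReal.ofReal p)) {g : E n → ℝ}
    (hg : Continuous g) (hc : HasCompactSupport g) :
    Integrable (Function.uncurry fun (x : E n) (t : ℝ) => t ^ k * f (dil w t x) * g x)
      (volume.prod (volume.restrict (Set.Ioo 0 1))) := by
  have hsm : StronglyMeasurable
      (Function.uncurry fun (x : E n) (t : ℝ) => t ^ k * f (dil w t x) * g x) :=
    (stronglyMeasurable_pow_smul_dil w k hfm).mul
      (hg.comp continuous_fst).stronglyMeasurable
  refine ⟨hsm.aestronglyMeasurable, ?_⟩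
  rw [hasFiniteIntegral_iff_enorm, lintegral_prod _ hsm.enorm.aemeasurable]
  obtain ⟨M, hM⟩ := hg.bounded_above_of_compact_support hc
  set V : E n → ℝ≥0∞ := fun x =>
    ∫⁻ t in Set.Ioo (0 : ℝ) 1, ENNReal.ofReal (t ^ k) * ‖f (dil w t x)‖ₑ with hV
  have h1 : ∀ x, ∫⁻ t in Set.Ioo (0 : ℝ) 1, ‖Function.uncurry
      (fun (x : E n) (t : ℝ) => t ^ k * f (dil w t x) * g x) (x, t)‖ₑ = V x * ‖g x‖ₑ := by
    intro x
    rw [hV]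
    simp only
    rw [← lintegral_mul_const' _ _ enorm_ne_top]
    refine setLIntegral_congr_fun measurableSet_Ioo fun t ht => ?_
    simp only [Function.uncurry]
    rw [enorm_mul, ← smul_eq_mul (t ^ k), enorm_pow_smul_of_mem k ht]
  -- This replaces Hölder's inequality: only finiteness on the compact support of `g` is needed.
  have h2 : ∀ v : ℝ≥0∞, v ≤ 1 + v ^ p := by
    intro v
    rcases le_total v 1 with h | h
    · exact h.trans le_self_add
    · calc v = v ^ (1 : ℝ) := (ENNReal.rpow_one v).symm
        _ ≤ v ^ p := ENNReal.rpow_le_rpow_of_exponent_le h hp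
        _ ≤ 1 + v ^ p := le_add_self
  simp only [h1]
  calc ∫⁻ x, V x * ‖g x‖ₑ
      ≤ ∫⁻ x, (tsupport g).indicator (fun x => (1 + V x ^ p) * ENNReal.ofReal M) x := by
        refine lintegral_mono fun x => ?_
        by_cases hx : x ∈ tsupport g
        · rw [Set.indicator_of_mem hx]
          refine mul_le_mul' (h2 _) ?_
          rw [← ofReal_norm]
          exact ENNReal.ofReal_le_ofReal (hM x)
        · simp [image_eq_zero_of_notMem_tsupport hx]
    _ = (∫⁻ x in tsupport g, (1 + V x ^ p)) * ENNReal.ofReal M := by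
        rw [lintegral_indicator (isClosed_tsupport g).measurableSet,
          lintegral_mul_const' _ _ ENNReal.ofReal_ne_top]
    _ < ∞ := by
        refine ENNReal.mul_lt_top ?_ ENNReal.ofReal_lt_top
        rw [lintegral_add_left measurable_const]
        refine ENNReal.add_lt_top.2 ⟨?_, ?_⟩
        · simpa using hc.isCompact.measure_lt_top
        · exact (setLIntegral_le_lintegral _ _).trans_lt (lintegral_cone_lt_top w k hp hb hfm hf)

/-- Hölder on the compact support of `g` together with the scaling `‖f ∘ dil w t‖_p = t^(-n/p)
‖f‖_p`. This decay rate makes the boundary term at `t = 0` disappear. -/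
lemma exists_abs_integral_dil_mul_le (w : E n) (hp : 1 ≤ p) {f : E n → ℝ}
    (hfm : StronglyMeasurable f) (hf : MemLp f (ENNReal.ofReal p)) {g : E n → ℝ}
    (hg : Continuous g) (hc : HasCompactSupport g) :
    ∃ c : ℝ, ∀ t : ℝ, 0 < t → |∫ x, f (dil w t x) * g x| ≤ t ^ (-(n / p)) * c := by
  have hp0 : 0 < p := by linarith
  obtain ⟨M, hM⟩ := hg.bounded_above_of_compact_support hc
  set K := tsupport g
  have hK : volume K < ∞ := hc.isCompact.measure_lt_top
  set N : ℝ≥0∞ := ∫⁻ x, ‖f x‖ₑ ^ p with hN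
  have hNt : N < ∞ := by
    have := lintegral_rpow_enorm_lt_top_of_eLpNorm_lt_top (by simpa using hp0)
      ENNReal.ofReal_ne_top hf.2
    rwa [ENNReal.toReal_ofReal hp0.le] at this
  set c : ℝ≥0∞ := N ^ (1 / p) * volume K ^ (1 - 1 / p) * ENNReal.ofReal M with hcdef
  have hp1 : 1 / p ≤ 1 := by rw [div_le_one hp0]; exact hp
  have hct : c ≠ ∞ := ENNReal.mul_ne_top (ENNReal.mul_ne_top
    (ENNReal.rpow_ne_top_of_nonneg (by positivity) hNt.ne)
    (ENNReal.rpow_ne_top_of_nonneg (by linarith) hK.ne)) ENNReal.ofReal_ne_top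
  refine ⟨c.toReal, fun t ht => ?_⟩
  have key : ‖∫ x, f (dil w t x) * g x‖ₑ ≤ ENNReal.ofReal (t ^ (-(n / p))) * c := by
    calc ‖∫ x, f (dil w t x) * g x‖ₑ ≤ ∫⁻ x, ‖f (dil w t x) * g x‖ₑ :=
          enorm_integral_le_lintegral_enorm _
      _ ≤ ∫⁻ x, K.indicator (fun x => ‖f (dil w t x)‖ₑ * ENNReal.ofReal M) x := by
          refine lintegral_mono fun x => ?_
          by_cases hx : x ∈ K
          · rw [Set.indicator_of_mem hx, enorm_mul]
            gcongr
            rw [← ofReal_norm]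
            exact ENNReal.ofReal_le_ofReal (hM x)
          · simp [image_eq_zero_of_notMem_tsupport hx]
      _ = (∫⁻ x in K, ‖f (dil w t x)‖ₑ) * ENNReal.ofReal M := by
          rw [lintegral_indicator (isClosed_tsupport g).measurableSet,
            lintegral_mul_const' _ _ ENNReal.ofReal_ne_top]
      _ ≤ ((∫⁻ x, ‖f (dil w t x)‖ₑ ^ p) ^ (1 / p) * volume K ^ (1 - 1 / p)) *
          ENNReal.ofReal M := by
          have h := eLpNorm'_le_eLpNorm'_mul_rpow_measure_univ (μ := volume.restrict K) one_pos hp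
            (hfm.comp_measurable (continuous_dil_right w t).measurable).aestronglyMeasurable
          simp only [eLpNorm'_eq_lintegral_enorm, ENNReal.rpow_one, div_one,
            Measure.restrict_apply_univ, Function.comp_apply] at h
          gcongr
          refine h.trans ?_
          gcongr
          exact Measure.restrict_le_self
      _ = ENNReal.ofReal (t ^ (-(n / p))) * c := by
          rw [lintegral_comp_dil w ht fun x => ‖f x‖ₑ ^ p,
            ENNReal.mul_rpow_of_nonneg _ _ (by positivity),
            ENNReal.ofReal_rpow_of_nonneg (by positivity) (by positivity), hcdef]
          have : ((t ^ n)⁻¹) ^ (1 / p) = t ^ (-(n / p)) := by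
            rw [← Real.rpow_natCast, ← Real.rpow_neg ht.le, ← Real.rpow_mul ht.le]
            congr 1; ring
          rw [this]; ring
  rw [← Real.norm_eq_abs, ← toReal_enorm]
  refine (ENNReal.toReal_mono (ENNReal.mul_ne_top ENNReal.ofReal_ne_top hct) key).trans_eq ?_
  rw [ENNReal.toReal_mul, ENNReal.toReal_ofReal (Real.rpow_nonneg ht.le _)]

end scalar

/-! ### Pairings with test forms and the weak homotopy formula. -/

section pairing

variable {n k m : ℕ}

/-- The integral over the whole space of the top degree form `h ∧ ψ`. -/
def pairing (h : E n → Covector n k) (ψ : E n → Covector n m) : ℝ :=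
  ∫ x, coeff Finset.univ (wedge (h x) (ψ x))

lemma integrable_coeff {h : E n → Covector n k} (hi : Integrable h) (A : Finset (Fin n)) :
    Integrable fun x => coeff A (h x) :=
  (coeff A).integrable_comp hi

lemma integrable_coeff_mul {h : E n → Covector n k} (hi : Integrable h) (A : Finset (Fin n))
    {g : E n → ℝ} (hg : Continuous g) (hc : HasCompactSupport g) :
    Integrable fun x => coeff A (h x) * g x := by
  obtain ⟨N, hN⟩ := hg.bounded_above_of_compact_support hc
  exact (integrable_coeff hi A).mul_bdd hg.aestronglyMeasurable
    (Filter.Eventually.of_forall hN)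

lemma continuous_coeff {ψ : E n → Covector n m} (hψ : Continuous ψ) (A : Finset (Fin n)) :
    Continuous fun x => coeff A (ψ x) :=
  (coeff A).continuous.comp hψ

lemma hasCompactSupport_coeff {ψ : E n → Covector n m} (hc : HasCompactSupport ψ)
    (A : Finset (Fin n)) : HasCompactSupport fun x => coeff A (ψ x) :=
  hc.comp_left (g := coeff A) (map_zero _)

lemma pairing_eq_sum (hkm : k + m = n) {h : E n → Covector n k} (hi : Integrable h)
    {ψ : E n → Covector n m} (hψ : Continuous ψ) (hc : HasCompactSupport ψ) :
    pairing h ψ =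
      ∑ A : Finset (Fin n), shuffleSign A Aᶜ * ∫ x, coeff A (h x) * coeff Aᶜ (ψ x) := by
  simp only [pairing, coeff_univ_wedge hkm]
  rw [integral_finsetSum]
  · refine Finset.sum_congr rfl fun A _ => ?_
    rw [← integral_const_mul]
    simp only [mul_assoc]
  · intro A _
    simpa only [mul_assoc] using (integrable_coeff_mul hi A (continuous_coeff hψ Aᶜ)
      (hasCompactSupport_coeff hc Aᶜ)).const_mul (shuffleSign A Aᶜ)

lemma hasCompactSupport_comp_dil {F : Type*} [Zero F] {ψ : E n → F} (hc : HasCompactSupport ψ)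
    (w : E n) {s : ℝ} (hs : s ≠ 0) : HasCompactSupport fun y => ψ (dil w s y) :=
  hc.comp_homeomorph (dilHomeo w hs)

/-- Composing with an expansion about `w` shrinks the support towards `w`, so dilated test forms
remain admissible in the ball. This is where the star shape of the domain enters. -/
lemma tsupport_comp_dil_subset {F : Type*} [Zero F] {ψ : E n → F} {w : E n} {R : ℝ}
    (hψ : tsupport ψ ⊆ Metric.ball w R) {s : ℝ} (hs : 1 ≤ s) :
    tsupport (fun y => ψ (dil w s y)) ⊆ Metric.ball w R := by
  have h1 : tsupport (fun y => ψ (dil w s y)) ⊆ dil w s ⁻¹' tsupport ψ :=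
    tsupport_comp_subset_preimage ψ (continuous_dil_right w s)
  intro y hy
  have h2 := hψ (h1 hy)
  simp only [Metric.mem_ball, dist_eq_norm, dil, add_sub_cancel_left, norm_smul,
    Real.norm_of_nonneg (zero_le_one.trans hs)] at h2 ⊢
  nlinarith [norm_nonneg (y - w)]

/-- Composition acts on coefficients only and is not a pullback, so the chain rule contributes a
single factor `s`. -/
lemma extDer_comp_dil {θ : E n → Covector n m} (hθ : ContDiff ℝ (⊤ : ℕ∞) θ) (w : E n) (s : ℝ)
    (y : E n) : extDer (fun y => θ (dil w s y)) y = s • extDer θ (dil w s y) := by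
  have hz : ∀ J, coeff J (extDer (fun y => θ (dil w s y)) y) =
      coeff J (s • extDer θ (dil w s y)) := by
    intro J
    rw [map_smul, coeff_extDer, coeff_extDer, Finset.smul_sum]
    refine Finset.sum_congr rfl fun i _ => ?_
    have hd : HasFDerivAt (dil w s) (s • ContinuousLinearMap.id ℝ (E n)) y := by
      have := (((hasFDerivAt_id (𝕜 := ℝ) y).sub_const w).const_smul s).const_add w
      exact this
    have h2 := (((contDiff_coeff hθ (J.erase i)).differentiable (by simp)
      (dil w s y)).hasFDerivAt.comp y hd).fderiv
    have h3 : fderiv ℝ (fun y => coeff (J.erase i) (θ (dil w s y))) y = _ := h2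
    rw [h3]
    simp only [ContinuousLinearMap.comp_apply, _root_.smul_apply, ContinuousLinearMap.id_apply,
      map_smul, smul_eq_mul]
    ring
  ext J
  rw [← coeff_self, ← coeff_self, hz]

lemma extDer_tsupport_subset (φ : E n → Covector n m) : tsupport (extDer φ) ⊆ tsupport φ := by
  refine closure_minimal (fun x hx => ?_) (isClosed_tsupport φ)
  by_contra hcon
  refine hx ?_
  have h0 : φ =ᶠ[nhds x] 0 := notMem_tsupport_iff_eventuallyEq.1 hcon
  ext J
  simp only [extDer, PiLp.zero_apply]
  refine Finset.sum_eq_zero fun i _ => ?_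
  have : (fun y => coeff (J.1.erase i) (φ y)) =ᶠ[nhds x] fun _ => (0 : ℝ) := by
    filter_upwards [h0] with y hy
    simp [hy]
  rw [this.fderiv_eq]
  simp

lemma interior_zero (v : E n) : interior v (0 : Covector n (k + 1)) = 0 := by
  ext J; simp [interior]

lemma support_interior_subset (w : E n) (φ : E n → Covector n (m + 1)) :
    Function.support (fun x => interior (x - w) (φ x)) ⊆ Function.support φ := by
  intro x hx hcon
  exact hx (by simp only; rw [hcon, interior_zero])

/-- A form on `ℝⁿ` is closed on `U` if it is orthogonal to the differentials of all test forms
supported in `U`. -/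
def WeaklyClosedOn (U : Set (E n)) (h : E n → Covector n (k + 1)) : Prop :=
  ∀ m : ℕ, k + 1 + (m + 1) = n → ∀ θ : E n → Covector n m, ContDiff ℝ (⊤ : ℕ∞) θ →
    HasCompactSupport θ → tsupport θ ⊆ U → pairing h (extDer θ) = 0

variable {w : E n} {R : ℝ} {h : E n → Covector n (k + 1)}

/-- By Cartan's formula the bracket is the coefficient of `d ι_X φ` at the dilated point, and
closedness of `h` is tested against the dilate of `ι_X φ`. -/
lemma sum_integral_lie_eq_zero (hi : Integrable h) (hcl : WeaklyClosedOn (Metric.ball w R) h)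
    (hkm : k + 1 + m = n) {φ : E n → Covector n m} (hφ : ContDiff ℝ (⊤ : ℕ∞) φ)
    (hc : HasCompactSupport φ) (hs : tsupport φ ⊆ Metric.ball w R) {s : ℝ} (h1 : 1 ≤ s) :
    ∑ A : Finset (Fin n), shuffleSign A Aᶜ * ∫ y, coeff A (h y) *
      (m * coeff Aᶜ (φ (dil w s y)) +
        fderiv ℝ (fun z => coeff Aᶜ (φ z)) (dil w s y) (dil w s y - w) -
        coeff Aᶜ (interior (dil w s y - w) (extDer φ (dil w s y)))) = 0 := by
  have hcard : ∀ A : Finset (Fin n), A.card = k + 1 → Aᶜ.card = m := by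
    intro A hA
    rw [Finset.card_compl, hA, Fintype.card_fin]; omega
  cases m with
  -- For functions `ι_X φ` is absent: the sum in Cartan's formula is empty and the integrand
  -- vanishes without using closedness.
  | zero =>
    refine Finset.sum_eq_zero fun A _ => ?_
    by_cases hA : A.card = k + 1
    · have hJ := hcard A hA
      have he : Aᶜ = ∅ := Finset.card_eq_zero.1 hJ
      simp only [coeff_interior_extDer hφ w _ hJ]
      simp [he]
    · simp [coeff_of_ne hA]
  | succ m =>
    set θ : E n → Covector n m := fun x => interior (x - w) (φ x) with hθdef
    have hθ : ContDiff ℝ (⊤ : ℕ∞) θ := contDiff_interior w hφ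
    have hθs : tsupport θ ⊆ tsupport φ := closure_mono (support_interior_subset w φ)
    have hθc : HasCompactSupport θ := hc.mono (support_interior_subset w φ)
    have hs0 : s ≠ 0 := by linarith
    have hθd : ContDiff ℝ (⊤ : ℕ∞) fun y => θ (dil w s y) := hθ.comp (contDiff_dil w s)
    have hcl' := hcl m hkm (fun y => θ (dil w s y)) hθd
      (hasCompactSupport_comp_dil hθc w hs0) (tsupport_comp_dil_subset (hθs.trans hs) h1)
    rw [pairing_eq_sum (by omega) hi (extDer_continuous hθd)
      (extDer_hasCompactSupport (hasCompactSupport_comp_dil hθc w hs0))] at hcl'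
    refine (mul_eq_zero.1 (?_ : s * _ = 0)).resolve_left hs0
    rw [← hcl', Finset.mul_sum]
    refine Finset.sum_congr rfl fun A _ => ?_
    rw [mul_left_comm, ← integral_const_mul]
    congr 1
    refine integral_congr_ae (Filter.Eventually.of_forall fun y => ?_)
    simp only
    by_cases hA : A.card = k + 1
    · have hJ := hcard A hA
      have e : coeff Aᶜ (extDer θ (dil w s y)) = ∑ l ∈ Aᶜ, shuffleSign {l} (Aᶜ.erase l) *
          fderiv ℝ (fun y => ∑ i ∈ (Aᶜ.erase l)ᶜ, shuffleSign {i} (Aᶜ.erase l) * (y - w) i *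
            coeff (insert i (Aᶜ.erase l)) (φ y)) (dil w s y) (EuclideanSpace.single l 1) := by
        rw [coeff_extDer]
        simp only [hθdef, coeff_interior]
      rw [coeff_interior_extDer hφ w _ hJ, extDer_comp_dil hθ, map_smul, smul_eq_mul, e]
      ring
    · simp [coeff_of_ne hA]

/-- Differentiation produces the derivative of the coefficients along `X`, which Cartan's formula
rewrites as `ι_X dφ - m φ` plus an exact term invisible to `h`. -/
lemma hasDerivAt_pairing_dil (hi : Integrable h) (hcl : WeaklyClosedOn (Metric.ball w R) h)
    (hkm : k + 1 + m = n) {φ : E n → Covector n m} (hφ : ContDiff ℝ (⊤ : ℕ∞) φ)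
    (hc : HasCompactSupport φ) (hs : tsupport φ ⊆ Metric.ball w R) {s : ℝ} (h1 : 1 ≤ s) :
    HasDerivAt (fun s => pairing h fun y => φ (dil w s y))
      (s⁻¹ * (pairing h (fun y => interior (dil w s y - w) (extDer φ (dil w s y))) -
        m * pairing h fun y => φ (dil w s y))) s := by
  have hs0 : 0 < s := by linarith
  have hψ : ContDiff ℝ (⊤ : ℕ∞) fun x => interior (x - w) (extDer φ x) :=
    contDiff_interior w (contDiff_extDer hφ)
  have hψc : HasCompactSupport fun x => interior (x - w) (extDer φ x) :=
    (extDer_hasCompactSupport hc).mono (support_interior_subset w _)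
  have hXc : ∀ A, Continuous fun x => fderiv ℝ (fun z => coeff A (φ z)) x (x - w) := fun A =>
    ((contDiff_coeff hφ A).continuous_fderiv (by simp)).clm_apply (by fun_prop)
  have hXs : ∀ A, HasCompactSupport fun x => fderiv ℝ (fun z => coeff A (φ z)) x (x - w) := by
    intro A
    refine HasCompactSupport.intro (K := tsupport (fderiv ℝ fun z => coeff A (φ z)))
      ((hasCompactSupport_coeff hc A).fderiv ℝ) fun x hx => ?_
    rw [image_eq_zero_of_notMem_tsupport hx]; simp
  have hW : ∀ r : ℝ, 0 < r → pairing h (fun y => φ (dil w r y)) =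
      ∑ A : Finset (Fin n), shuffleSign A Aᶜ *
        ∫ x, coeff A (h x) * coeff Aᶜ (φ (dil w r x)) := fun r hr =>
    pairing_eq_sum hkm hi (hφ.continuous.comp (continuous_dil_right w r))
      (hasCompactSupport_comp_dil hc w hr.ne')
  have hder : HasDerivAt (fun r => ∑ A : Finset (Fin n), shuffleSign A Aᶜ *
      ∫ x, coeff A (h x) * coeff Aᶜ (φ (dil w r x)))
      (∑ A : Finset (Fin n), shuffleSign A Aᶜ * (s⁻¹ * ∫ y, coeff A (h y) *
        fderiv ℝ (fun z => coeff Aᶜ (φ z)) (dil w s y) (dil w s y - w))) s :=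
    HasDerivAt.fun_sum fun A _ => (hasDerivAt_integral_mul_dil w (integrable_coeff hi A)
      (contDiff_coeff hφ Aᶜ) (hasCompactSupport_coeff hc Aᶜ) hs0).const_mul _
  have hder' : HasDerivAt (fun s => pairing h fun y => φ (dil w s y)) _ s :=
    hder.congr_of_eventuallyEq (Filter.eventuallyEq_of_mem (Ioi_mem_nhds hs0) hW)
  convert hder' using 1
  have hzero := sum_integral_lie_eq_zero hi hcl hkm hφ hc hs h1
  have hint : ∀ (A : Finset (Fin n)) {g : E n → ℝ}, Continuous g → HasCompactSupport g →
      Integrable fun y => coeff A (h y) * g (dil w s y) := fun A g hg hgc =>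
    integrable_coeff_mul hi A (hg.comp (continuous_dil_right w s))
      (hasCompactSupport_comp_dil hgc w hs0.ne')
  have hsplit : ∀ A : Finset (Fin n), ∫ y, coeff A (h y) *
      (m * coeff Aᶜ (φ (dil w s y)) +
        fderiv ℝ (fun z => coeff Aᶜ (φ z)) (dil w s y) (dil w s y - w) -
        coeff Aᶜ (interior (dil w s y - w) (extDer φ (dil w s y)))) =
      m * (∫ y, coeff A (h y) * coeff Aᶜ (φ (dil w s y))) +
      (∫ y, coeff A (h y) * fderiv ℝ (fun z => coeff Aᶜ (φ z)) (dil w s y) (dil w s y - w)) -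
      ∫ y, coeff A (h y) * coeff Aᶜ (interior (dil w s y - w) (extDer φ (dil w s y))) := by
    intro A
    have i1 := (hint A (contDiff_coeff hφ Aᶜ).continuous (hasCompactSupport_coeff hc Aᶜ)).const_mul
      (m : ℝ)
    have i2 := hint A (hXc Aᶜ) (hXs Aᶜ)
    have i3 := hint A (contDiff_coeff hψ Aᶜ).continuous (hasCompactSupport_coeff hψc Aᶜ)
    have i12 : Integrable fun y => m * (coeff A (h y) * coeff Aᶜ (φ (dil w s y))) +
      coeff A (h y) * fderiv ℝ (fun z => coeff Aᶜ (φ z)) (dil w s y) (dil w s y - w) := i1.add i2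
    rw [← integral_const_mul, ← integral_add i1 i2, ← integral_sub i12 i3]
    exact integral_congr_ae (Filter.Eventually.of_forall fun y => by ring)
  simp only [hsplit] at hzero
  simp only [mul_add, mul_sub, Finset.sum_add_distrib, Finset.sum_sub_distrib] at hzero
  rw [hW s hs0, pairing_eq_sum hkm hi
    (ψ := fun y => interior (dil w s y - w) (extDer φ (dil w s y)))
    (hψ.continuous.comp (continuous_dil_right w s))
    (hasCompactSupport_comp_dil hψc w hs0.ne')]
  simp only [mul_left_comm _ s⁻¹, mul_left_comm _ (m : ℝ), ← Finset.mul_sum] at hzero ⊢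
  congr 1
  linarith

/-- The cone average `∫₀¹ t^k h(w + t(x - w)) dt`. -/
def cone {F : Type*} [NormedAddCommGroup F] [NormedSpace ℝ F] (w : E n) (k : ℕ) (h : E n → F)
    (x : E n) : F :=
  ∫ t in Set.Ioo (0 : ℝ) 1, t ^ k • h (dil w t x)

lemma stronglyMeasurable_cone {F : Type*} [NormedAddCommGroup F] [NormedSpace ℝ F] (w : E n)
    (k : ℕ) {h : E n → F} (hm : StronglyMeasurable h) : StronglyMeasurable (cone w k h) :=
  (stronglyMeasurable_pow_smul_dil w k hm).integral_prod_right

variable {p : ℝ}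

/-- Fubini, then the substitution `y = dil w t x`, whose Jacobian is the factor `(t ^ n)⁻¹`, moves
the dilation from `h` to the test form. -/
lemma pairing_cone (w : E n) (hp : 1 ≤ p) (hb : 0 < k + 1 - n / p) (hm : StronglyMeasurable h)
    (hL : MemLp h (ENNReal.ofReal p)) (hi : Integrable h) (hkm : k + 1 + m = n)
    {ψ : E n → Covector n m} (hψ : Continuous ψ) (hc : HasCompactSupport ψ) :
    IntegrableOn (fun t => t ^ k * (t ^ n)⁻¹ * pairing h fun y => ψ (dil w t⁻¹ y))
        (Set.Ioo 0 1) ∧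
      pairing (cone w k h) ψ =
        ∫ t in Set.Ioo (0 : ℝ) 1, t ^ k * (t ^ n)⁻¹ * pairing h fun y => ψ (dil w t⁻¹ y) := by
  have hfm : ∀ A : Finset (Fin n), StronglyMeasurable fun x => coeff A (h x) := fun A =>
    (coeff A).continuous.comp_stronglyMeasurable hm
  have hfL : ∀ A : Finset (Fin n), MemLp (fun x => coeff A (h x)) (ENNReal.ofReal p) := fun A =>
    (coeff A).comp_memLp' hL
  have hI := fun A : Finset (Fin n) => integrable_cone_mul w k hp hb (hfm A) (hfL A)
    (continuous_coeff hψ Aᶜ) (hasCompactSupport_coeff hc Aᶜ)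
  have hint : ∀ A : Finset (Fin n), Integrable
      (fun t => ∫ x, t ^ k * coeff A (h (dil w t x)) * coeff Aᶜ (ψ x))
      (volume.restrict (Set.Ioo (0 : ℝ) 1)) := fun A => (hI A).integral_prod_right
  have hslice : ∀ t ∈ Set.Ioo (0 : ℝ) 1,
      ∑ A : Finset (Fin n), shuffleSign A Aᶜ *
        ∫ x, t ^ k * coeff A (h (dil w t x)) * coeff Aᶜ (ψ x) =
      t ^ k * (t ^ n)⁻¹ * pairing h fun y => ψ (dil w t⁻¹ y) := by
    intro t ht
    rw [pairing_eq_sum hkm hi (ψ := fun y => ψ (dil w t⁻¹ y))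
      (hψ.comp (continuous_dil_right w t⁻¹))
      (hasCompactSupport_comp_dil hc w (inv_ne_zero ht.1.ne')), Finset.mul_sum]
    refine Finset.sum_congr rfl fun A _ => ?_
    simp only [mul_assoc]
    rw [integral_const_mul, integral_dil_mul w (fun y => coeff A (h y)) _ ht.1]
    ring
  have hsumint : Integrable (fun t => ∑ A : Finset (Fin n), shuffleSign A Aᶜ *
        ∫ x, t ^ k * coeff A (h (dil w t x)) * coeff Aᶜ (ψ x))
      (volume.restrict (Set.Ioo (0 : ℝ) 1)) :=
    integrable_finsetSum _ fun A _ => (hint A).const_mul _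
  refine ⟨hsumint.congr ((ae_restrict_mem measurableSet_Ioo).mono hslice), ?_⟩
  rw [← setIntegral_congr_fun measurableSet_Ioo hslice,
    integral_finsetSum _ fun A _ => (hint A).const_mul _]
  have hae : ∀ᵐ x, coeff Finset.univ (wedge (cone w k h x) (ψ x)) =
      ∑ A : Finset (Fin n), shuffleSign A Aᶜ *
        ∫ t in Set.Ioo (0 : ℝ) 1, t ^ k * coeff A (h (dil w t x)) * coeff Aᶜ (ψ x) := by
    filter_upwards [ae_integrable_cone w k hp hb hm hL] with x hx
    rw [coeff_univ_wedge hkm]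
    refine Finset.sum_congr rfl fun A _ => ?_
    rw [integral_mul_const, mul_assoc]
    congr 2
    rw [cone, ← ContinuousLinearMap.integral_comp_comm _ hx]
    simp
  have hleft : ∀ A : Finset (Fin n), Integrable fun x =>
      ∫ t in Set.Ioo (0 : ℝ) 1, t ^ k * coeff A (h (dil w t x)) * coeff Aᶜ (ψ x) := fun A =>
    (hI A).integral_prod_left
  rw [pairing, integral_congr_ae hae, integral_finsetSum _ fun A _ => (hleft A).const_mul _]
  refine Finset.sum_congr rfl fun A _ => ?_
  rw [integral_const_mul, integral_const_mul, integral_integral_swap (hI A)]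

/-- Undoing the substitution turns `t^(-m)` into `t^(k+1)`, as `n = k + 1 + m`; against the growth
`t^(-n/p)` this leaves the positive power `k + 1 - n/p`. -/
lemma tendsto_pairing_dil_zero (w : E n) (hp : 1 ≤ p) (hb : 0 < k + 1 - n / p)
    (hm : StronglyMeasurable h) (hL : MemLp h (ENNReal.ofReal p)) (hi : Integrable h)
    (hkm : k + 1 + m = n) {φ : E n → Covector n m} (hφ : Continuous φ)
    (hc : HasCompactSupport φ) :
    Filter.Tendsto (fun t : ℝ => t⁻¹ ^ m * pairing h fun y => φ (dil w t⁻¹ y))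
      (nhdsWithin 0 (Set.Ioi 0)) (nhds 0) := by
  have hsum : ∀ t ∈ Set.Ioi (0 : ℝ), ∑ A : Finset (Fin n), t ^ (k + 1) * (shuffleSign A Aᶜ *
      ∫ x, coeff A (h (dil w t x)) * coeff Aᶜ (φ x)) =
      t⁻¹ ^ m * pairing h fun y => φ (dil w t⁻¹ y) := by
    intro t ht
    have ht0 : t ≠ 0 := ne_of_gt ht
    rw [pairing_eq_sum hkm hi (ψ := fun y => φ (dil w t⁻¹ y))
      (hφ.comp (continuous_dil_right w t⁻¹))
      (hasCompactSupport_comp_dil hc w (inv_ne_zero ht0)), Finset.mul_sum]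
    refine Finset.sum_congr rfl fun A _ => ?_
    rw [integral_dil_mul w (fun y => coeff A (h y)) _ ht]
    have : t ^ n = t ^ (k + 1) * t ^ m := by rw [← pow_add, hkm]
    rw [this, inv_pow]
    generalize ∫ y, coeff A (h y) * coeff Aᶜ (φ (dil w t⁻¹ y)) = I
    field_simp
  refine Filter.Tendsto.congr' (Filter.eventuallyEq_of_mem self_mem_nhdsWithin hsum) ?_
  suffices hA : ∀ A : Finset (Fin n), Filter.Tendsto (fun t : ℝ => t ^ (k + 1) *
      (shuffleSign A Aᶜ * ∫ x, coeff A (h (dil w t x)) * coeff Aᶜ (φ x)))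
      (nhdsWithin 0 (Set.Ioi 0)) (nhds 0) by
    simpa using tendsto_finsetSum Finset.univ fun A _ => hA A
  intro A
  obtain ⟨c, hc⟩ := exists_abs_integral_dil_mul_le w hp
    ((coeff A).continuous.comp_stronglyMeasurable hm) ((coeff A).comp_memLp' hL)
    (continuous_coeff hφ Aᶜ) (hasCompactSupport_coeff hc Aᶜ)
  have hlim : Filter.Tendsto (fun t : ℝ => |shuffleSign A Aᶜ| * (t ^ ((k : ℝ) + 1 - n / p) * c))
      (nhdsWithin 0 (Set.Ioi 0)) (nhds 0) := by
    have h1 := (Real.continuousAt_rpow_const 0 ((k : ℝ) + 1 - n / p) (Or.inr hb.le)).tendsto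
    rw [Real.zero_rpow hb.ne'] at h1
    simpa using ((h1.mono_left nhdsWithin_le_nhds).mul_const c).const_mul |shuffleSign A Aᶜ|
  refine squeeze_zero_norm' (Filter.eventually_of_mem self_mem_nhdsWithin fun t ht => ?_) hlim
  have ht' : 0 < t := ht
  rw [norm_mul, norm_mul, Real.norm_of_nonneg (by positivity), Real.norm_eq_abs,
    Real.norm_eq_abs, mul_left_comm]
  refine mul_le_mul_of_nonneg_left ?_ (abs_nonneg _)
  refine (mul_le_mul_of_nonneg_left (hc t ht') (by positivity)).trans_eq ?_
  rw [← mul_assoc, ← Real.rpow_natCast, ← Real.rpow_add ht']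
  push_cast
  ring_nf

/-- The cone operator inverts the differential on closed forms. -/
lemma pairing_interior_cone (hp : 1 ≤ p) (hb : 0 < k + 1 - n / p) (hm : StronglyMeasurable h)
    (hL : MemLp h (ENNReal.ofReal p)) (hi : Integrable h)
    (hcl : WeaklyClosedOn (Metric.ball w R) h) (hkm : k + 1 + m = n) {φ : E n → Covector n m}
    (hφ : ContDiff ℝ (⊤ : ℕ∞) φ) (hc : HasCompactSupport φ)
    (hs : tsupport φ ⊆ Metric.ball w R) :
    pairing (fun x => interior (x - w) (cone w k h x)) (extDer φ) =
      (-1) ^ (k + 1) * pairing h φ := by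
  set ψ : E n → Covector n m := fun x => interior (x - w) (extDer φ x) with hψdef
  have hψ : ContDiff ℝ (⊤ : ℕ∞) ψ := contDiff_interior w (contDiff_extDer hφ)
  have hψc : HasCompactSupport ψ :=
    (extDer_hasCompactSupport hc).mono (support_interior_subset w _)
  obtain ⟨hint, hcone⟩ := pairing_cone w hp hb hm hL hi hkm hψ.continuous hψc
  have h1 : pairing (fun x => interior (x - w) (cone w k h x)) (extDer φ) =
      (-1) ^ k * pairing (cone w k h) ψ := by
    rw [pairing, pairing, ← integral_const_mul]
    exact integral_congr_ae (Filter.Eventually.of_forall fun x =>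
      coeff_univ_wedge_interior (by omega) _ _ _)
  -- The factor `t⁻¹ ^ m` makes this the pairing of `h` with the true pullback of `φ`; in its
  -- derivative the terms carrying `m` cancel.
  set G : ℝ → ℝ := fun t => t⁻¹ ^ m * pairing h fun y => φ (dil w t⁻¹ y) with hG
  have hder : ∀ t ∈ Set.Ioc (0 : ℝ) 1, HasDerivAt G
      (-(t ^ k * (t ^ n)⁻¹ * pairing h fun y => ψ (dil w t⁻¹ y))) t := by
    intro t ht
    have ht0 : t ≠ 0 := ht.1.ne'
    -- The truncated exponent at `m = 0` is harmless because of the factor `m`.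
    have hpow : (m : ℝ) * t⁻¹ ^ (m - 1) = m * t⁻¹ ^ m * t := by
      cases m with
      | zero => simp
      | succ m => rw [Nat.add_sub_cancel, pow_succ]; field_simp
    have hd := (hasDerivAt_pow m t⁻¹).mul (hasDerivAt_pairing_dil hi hcl hkm hφ hc hs
      (one_le_inv₀ ht.1 |>.2 ht.2))
    have hd2 := HasDerivAt.comp t hd (hasDerivAt_inv ht0)
    have e : t ^ n = t ^ k * t * t ^ m := by rw [← pow_succ, ← pow_add, hkm]
    refine HasDerivAt.congr_deriv (f := G) hd2 ?_
    rw [hpow, e, inv_pow]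
    simp only [hψdef]
    generalize (pairing h fun y => interior (dil w t⁻¹ y - w) (extDer φ (dil w t⁻¹ y))) = I,
      (pairing h fun y => φ (dil w t⁻¹ y)) = I'
    field_simp
    ring
  have hFTC := intervalIntegral.integral_eq_sub_of_hasDerivAt_of_tendsto (zero_lt_one' ℝ)
    (fun t ht => hder t ⟨ht.1, ht.2.le⟩) ?_
    (tendsto_pairing_dil_zero w hp hb hm hL hi hkm hφ.continuous hc)
    ((hder 1 (by simp)).continuousAt.tendsto.mono_left nhdsWithin_le_nhds)
  · rw [intervalIntegral.integral_of_le zero_le_one, integral_Ioc_eq_integral_Ioo, integral_neg,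
      ← hcone] at hFTC
    have hG1 : G 1 = pairing h φ := by simp [hG]
    rw [h1, pow_succ, ← hG1]
    linear_combination (-(-1) ^ k) * hFTC
  · rw [intervalIntegrable_iff_integrableOn_Ioo_of_le zero_le_one]
    exact hint.neg

end pairing

/-! ### The cone primitive on a ball and its norm. -/

section main

variable {n k : ℕ} {p : ℝ}

lemma stronglyMeasurable_interior (w : E n) {h : E n → Covector n (k + 1)} (hm : StronglyMeasurable h) :
    StronglyMeasurable fun x => interior (x - w) (h x) := by
  refine Measurable.stronglyMeasurable ?_
  refine (WithLp.measurable_toLp 2 _).comp (measurable_pi_lambda _ fun J => ?_)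
  refine Finset.measurable_sum _ fun i _ => ?_
  refine Measurable.mul (measurable_const.mul ?_)
    ((coeff (insert i J.1)).continuous.measurable.comp hm.measurable)
  exact ((EuclideanSpace.proj (𝕜 := ℝ) i).continuous.comp
    (continuous_id.sub continuous_const)).measurable

lemma eLpNorm_interior_cone_le (w : E n) {R : ℝ} (hR : 0 ≤ R) (hp : 1 ≤ p)
    (hb : 0 < k + 1 - n / p) {h : E n → Covector n (k + 1)} (hm : StronglyMeasurable h) :
    eLpNorm (fun x => interior (x - w) (cone w k h x)) (ENNReal.ofReal p)
        (volume.restrict (Metric.ball w R)) ≤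
      ENNReal.ofReal (Real.sqrt (n.choose k) * R * (k + 1 - n / p)⁻¹) *
        eLpNorm h (ENNReal.ofReal p) volume := by
  have hp0 : 0 < p := by linarith
  have hpt : ∀ x ∈ Metric.ball w R, ‖interior (x - w) (cone w k h x)‖ₑ ≤
      ENNReal.ofReal (Real.sqrt (n.choose k) * R) *
        ∫⁻ t in Set.Ioo (0 : ℝ) 1, ENNReal.ofReal (t ^ k) * ‖h (dil w t x)‖ₑ := by
    intro x hx
    have hx' : ‖x - w‖ ≤ R := by rw [← dist_eq_norm]; exact (Metric.mem_ball.1 hx).le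
    have h1 : ‖cone w k h x‖ₑ ≤
        ∫⁻ t in Set.Ioo (0 : ℝ) 1, ENNReal.ofReal (t ^ k) * ‖h (dil w t x)‖ₑ := by
      refine (enorm_integral_le_lintegral_enorm _).trans_eq ?_
      exact setLIntegral_congr_fun measurableSet_Ioo fun t ht => enorm_pow_smul_of_mem k ht _
    calc ‖interior (x - w) (cone w k h x)‖ₑ
        = ENNReal.ofReal ‖interior (x - w) (cone w k h x)‖ := (ofReal_norm _).symm
      _ ≤ ENNReal.ofReal (Real.sqrt (n.choose k) * R * ‖cone w k h x‖) := by
          refine ENNReal.ofReal_le_ofReal ((norm_interior_le _ _).trans ?_)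
          gcongr
      _ = ENNReal.ofReal (Real.sqrt (n.choose k) * R) * ‖cone w k h x‖ₑ := by
          rw [ENNReal.ofReal_mul (by positivity), ofReal_norm]
      _ ≤ _ := by gcongr
  have hpne : ENNReal.ofReal p ≠ 0 := by simpa using hp0
  rw [eLpNorm_eq_lintegral_rpow_enorm_toReal hpne ENNReal.ofReal_ne_top,
    eLpNorm_eq_lintegral_rpow_enorm_toReal hpne ENNReal.ofReal_ne_top,
    ENNReal.toReal_ofReal hp0.le]
  set c := ENNReal.ofReal (Real.sqrt (n.choose k) * R) with hc
  have h2 : ∫⁻ x in Metric.ball w R, ‖interior (x - w) (cone w k h x)‖ₑ ^ p ≤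
      c ^ p * (ENNReal.ofReal ((k + 1 - n / p)⁻¹) ^ p * ∫⁻ x, ‖h x‖ₑ ^ p) := by
    calc ∫⁻ x in Metric.ball w R, ‖interior (x - w) (cone w k h x)‖ₑ ^ p
        ≤ ∫⁻ x in Metric.ball w R, c ^ p * (∫⁻ t in Set.Ioo (0 : ℝ) 1,
            ENNReal.ofReal (t ^ k) * ‖h (dil w t x)‖ₑ) ^ p := by
          refine setLIntegral_mono' measurableSet_ball fun x hx => ?_
          rw [← ENNReal.mul_rpow_of_nonneg _ _ hp0.le]
          exact ENNReal.rpow_le_rpow (hpt x hx) hp0.le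
      _ ≤ ∫⁻ x, c ^ p * (∫⁻ t in Set.Ioo (0 : ℝ) 1,
            ENNReal.ofReal (t ^ k) * ‖h (dil w t x)‖ₑ) ^ p := setLIntegral_le_lintegral _ _
      _ = c ^ p * ∫⁻ x, (∫⁻ t in Set.Ioo (0 : ℝ) 1,
            ENNReal.ofReal (t ^ k) * ‖h (dil w t x)‖ₑ) ^ p :=
          lintegral_const_mul' _ _ (ENNReal.rpow_ne_top_of_nonneg hp0.le ENNReal.ofReal_ne_top)
      _ ≤ _ := by
          gcongr
          exact lintegral_cone_le w k hp hb hm.enorm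
  calc _ ≤ (c ^ p * (ENNReal.ofReal ((k + 1 - n / p)⁻¹) ^ p * ∫⁻ x, ‖h x‖ₑ ^ p)) ^ (1 / p) := by
        gcongr
    _ = _ := by
        rw [ENNReal.mul_rpow_of_nonneg _ _ (by positivity),
          ENNReal.mul_rpow_of_nonneg _ _ (by positivity), ← ENNReal.rpow_mul, ← ENNReal.rpow_mul,
          mul_one_div_cancel hp0.ne', ENNReal.rpow_one, ENNReal.rpow_one, ← mul_assoc, hc,
          ← ENNReal.ofReal_mul (by positivity)]

lemma integralTop_eq_pairing_indicator {l m : ℕ} (hkm : l + m = n)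
    (D : TopologicalSpace.Opens (E n)) (θ : E n → Covector n l) (ψ : E n → Covector n m) :
    integralTop D (fun x => wedge (θ x) (ψ x)) = pairing ((D : Set (E n)).indicator θ) ψ := by
  rw [integralTop, pairing, ← integral_indicator D.isOpen.measurableSet]
  refine integral_congr_ae (Filter.Eventually.of_forall fun x => ?_)
  by_cases hx : x ∈ (D : Set (E n))
  · simp only [Set.indicator_of_mem hx]
  · simp only [Set.indicator_of_notMem hx]
    rw [coeff_univ_wedge hkm]
    simp

lemma integralTop_eq_pairing_of_tsupport_subset {l m : ℕ} (hkm : l + m = n)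
    (D : TopologicalSpace.Opens (E n)) (θ : E n → Covector n l) {ψ : E n → Covector n m}
    (hψ : tsupport ψ ⊆ D) :
    integralTop D (fun x => wedge (θ x) (ψ x)) = pairing θ ψ := by
  rw [integralTop, pairing]
  refine setIntegral_eq_integral_of_forall_compl_eq_zero fun x hx => ?_
  rw [coeff_univ_wedge hkm, image_eq_zero_of_notMem_tsupport fun h => hx (hψ h)]
  simp

variable [Fact (1 ≤ p)] {D : TopologicalSpace.Opens (E n)}

/-- Test the definition of `dζ` with the exact form `dθ` and use `d(dθ) = 0`. -/
lemma weaklyClosedOn_d (ζ : OmegaPP D k p) :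
    WeaklyClosedOn (D : Set (E n)) ((D : Set (E n)).indicator (d D k p ζ)) := by
  intro m hm θ hθ hθc hθs
  have h := isWeakDifferential_d ζ (m + 1) hm (extDer θ) (contDiff_extDer hθ)
    (extDer_hasCompactSupport hθc) ((extDer_tsupport_subset θ).trans hθs)
  have h0 : integralTop (D : Set (E n))
      (fun x => wedge ((ζ : Omega D k p) x) (extDer (extDer θ) x)) = 0 := by
    rw [integralTop_eq_pairing_indicator (by omega), pairing]
    simp only [extDer_extDer hθ, coeff_univ_wedge (show k + (m + 1 + 1) = n by omega)]
    simp
  rw [h0, integralTop_eq_pairing_indicator hm] at h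
  exact (mul_eq_zero.1 h.symm).resolve_left (by simp)

/-- Every class in `ℋ^k_p` of a ball is represented by the cone form of its differential. -/
lemma norm_mk_le_of_ball {w : E n} {R : ℝ} (hR : 0 ≤ R)
    (hD : (D : Set (E n)) = Metric.ball w R) (hb : 0 < k + 1 - n / p) (ζ : OmegaPP D k p) :
    ‖(Submodule.Quotient.mk ζ : HarmonicSpace D k p)‖ ≤
      Real.sqrt (n.choose k) * R * (k + 1 - n / p)⁻¹ * ‖d D k p ζ‖ := by
  have hp : 1 ≤ p := Fact.out
  have hDm : MeasurableSet (D : Set (E n)) := D.isOpen.measurableSet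
  set η := d D k p ζ with hη
  set h : E n → Covector n (k + 1) := (D : Set (E n)).indicator η with hh
  have hm : StronglyMeasurable h := (Lp.stronglyMeasurable η).indicator hDm
  have hL : MemLp h (ENNReal.ofReal p) := (memLp_indicator_iff_restrict hDm).2 (Lp.memLp η)
  -- Finite volume puts the `L^p` form `h` in `L^1`, which the pairings require.
  have hfin : IsFiniteMeasure (volume.restrict (D : Set (E n))) := by
    rw [hD]
    exact ⟨by rw [Measure.restrict_apply_univ]; exact measure_ball_lt_top⟩
  have hi : Integrable h := (integrable_indicator_iff hDm).2
    ((Lp.memLp η).integrable Fact.out)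
  have hcl : WeaklyClosedOn (Metric.ball w R) h := hD ▸ weaklyClosedOn_d ζ
  set K : E n → Covector n k := fun x => interior (x - w) (cone w k h x) with hK
  have hnorm : eLpNorm h (ENNReal.ofReal p) volume =
      eLpNorm η (ENNReal.ofReal p) (volume.restrict (D : Set (E n))) :=
    eLpNorm_indicator_eq_eLpNorm_restrict hDm
  have hle := eLpNorm_interior_cone_le w hR hp hb hm
  rw [← hD, hnorm] at hle
  have hlt : eLpNorm η (ENNReal.ofReal p) (volume.restrict (D : Set (E n))) < ∞ :=
    (Lp.memLp η).2
  have hKL : MemLp K (ENNReal.ofReal p) (volume.restrict (D : Set (E n))) :=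
    ⟨(stronglyMeasurable_interior w (stronglyMeasurable_cone w k hm)).aestronglyMeasurable,
      hle.trans_lt (ENNReal.mul_lt_top ENNReal.ofReal_lt_top hlt)⟩
  set κ : Omega D k p := hKL.toLp K with hκ
  have hweak : IsWeakDifferential (D : Set (E n)) κ η := by
    intro m hkm φ hφ hφc hφs
    have e1 : integralTop (D : Set (E n)) (fun x => wedge (κ x) (extDer φ x)) =
        integralTop (D : Set (E n)) (fun x => wedge (K x) (extDer φ x)) := by
      unfold integralTop
      refine integral_congr_ae ?_
      filter_upwards [hKL.coeFn_toLp] with x hx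
      rw [hx]
    rw [e1, integralTop_eq_pairing_of_tsupport_subset (by omega) D K
      ((extDer_tsupport_subset φ).trans hφs), integralTop_eq_pairing_indicator hkm]
    exact pairing_interior_cone hp hb hm hL hi hcl hkm hφ hφc (hD ▸ hφs)
  set κ' : OmegaPP D k p := ⟨κ, η, hweak⟩
  have hdκ : d D k p κ' = η := (isWeakDifferential_d κ').unique hweak
  -- Two forms with the same differential define the same class, so the norm of the class is bounded
  -- by that of the cone form.
  have hmk : (Submodule.Quotient.mk ζ : HarmonicSpace D k p) = Submodule.Quotient.mk κ' := by
    rw [Submodule.Quotient.eq, LinearMap.mem_ker, map_sub, hdκ, sub_self]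
  rw [hmk]
  refine (Submodule.Quotient.norm_mk_le _ κ').trans ?_
  have hc : 0 ≤ Real.sqrt (n.choose k) * R * (k + 1 - n / p)⁻¹ := by positivity
  change ‖κ‖ ≤ _
  rw [hκ, Lp.norm_toLp, Lp.norm_def, ← ENNReal.toReal_ofReal hc, ← ENNReal.toReal_mul]
  exact ENNReal.toReal_mono (ENNReal.mul_ne_top ENNReal.ofReal_ne_top hlt.ne) hle


end main

/-! ### Comparison of constants and conclusion. -/

/-- The constant of the cone operator is dominated by the one of the theorem. -/
lemma cone_constant_le {n k : ℕ} {p C : ℝ} (hk : 2 ≤ k) (hkn : k < n) (hp1 : 1 ≤ p)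
    (hp : ((n : ℝ) - 1) / ((k : ℝ) - 1) < p) (hC : 0 < C) :
    Real.sqrt (n.choose k) * (1 / C) * (k + 1 - n / p)⁻¹ ≤
      Real.sqrt (n.choose k) * ((n : ℝ) - k + 1) /
          (C * (p * ((k : ℝ) - 1) - n + 1) ^ (1 / p)) *
        ((n.factorial : ℝ) ^ ((p + 1) / p) / ((n + 1 - k).factorial : ℝ)) ^ 2 := by
  have hp0 : 0 < p := by linarith
  have hk1 : (0 : ℝ) < k - 1 := by
    have : (2 : ℝ) ≤ k := by exact_mod_cast hk
    linarith
  set q : ℝ := p * ((k : ℝ) - 1) - n + 1 with hq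
  have hq0 : 0 < q := by
    rw [div_lt_iff₀ hk1] at hp
    linarith
  have hqp : q ^ (1 / p) ≤ (q + 2 * p - 1) / p := by
    -- Bernoulli's inequality with exponent `1 / p ≤ 1` gives `q^(1/p) ≤ (p + q - 1)/p`. Adding `1`
    -- yields the weaker bound `(q + 2p - 1)/p`, which is `k + 1 - n/p`.
    have h := rpow_one_add_le_one_add_mul_self (s := q - 1) (by linarith)
      (p := 1 / p) (by positivity) (by rw [div_le_one hp0]; exact hp1)
    rw [add_sub_cancel] at h
    refine h.trans ?_
    rw [show 1 + 1 / p * (q - 1) = (p + q - 1) / p by field_simp; ring]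
    exact div_le_div_of_nonneg_right (by linarith) hp0.le
  have hfac : (1 : ℝ) ≤ (n.factorial : ℝ) ^ ((p + 1) / p) / ((n + 1 - k).factorial : ℝ) := by
    rw [one_le_div (by positivity)]
    have h1 : ((n + 1 - k).factorial : ℝ) ≤ n.factorial := by
      exact_mod_cast Nat.factorial_le (by omega)
    refine h1.trans ?_
    have h2 : (1 : ℝ) ≤ n.factorial := by exact_mod_cast Nat.factorial_pos n
    have h3 : 1 ≤ (p + 1) / p := by rw [one_le_div hp0]; linarith
    simpa using Real.rpow_le_rpow_of_exponent_le h2 h3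
  have hnk : (1 : ℝ) ≤ (n : ℝ) - k + 1 := by
    have : (k : ℝ) ≤ n := by exact_mod_cast hkn.le
    linarith
  have hinv : ((k : ℝ) + 1 - n / p)⁻¹ ≤ 1 / q ^ (1 / p) := by
    have e : (k : ℝ) + 1 - n / p = (q + 2 * p - 1) / p := by rw [hq]; field_simp; ring
    rw [e, ← one_div]
    exact one_div_le_one_div_of_le (Real.rpow_pos_of_pos hq0 _) hqp
  have hQ : 0 < q ^ (1 / p) := Real.rpow_pos_of_pos hq0 _
  calc Real.sqrt (n.choose k) * (1 / C) * (k + 1 - n / p)⁻¹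
      ≤ Real.sqrt (n.choose k) * (1 / C) * (1 / q ^ (1 / p)) := by gcongr
    _ = Real.sqrt (n.choose k) * 1 / (C * q ^ (1 / p)) * 1 := by field_simp
    _ ≤ _ := by
        gcongr
        exact one_le_pow₀ hfac

end LpForms

end

theorem mainTheorem6 (n k : ℕ) (hk : 2 ≤ k) (p : ℝ) [Fact (1 ≤ p)]
    (hp : ((n : ℝ) - 1) / ((k : ℝ) - 1) < p) (C : ℝ) (hC : 0 < C)
    (D : TopologicalSpace.Opens (LpForms.E n)) (z : LpForms.E n)
    (hD : LpForms.BiLipschitzHomeomorphic C (D : Set (LpForms.E n)) (Metric.ball z 1))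
    (ω : LpForms.HarmonicSpace D k p) :
    ‖ω‖ ≤
      Real.sqrt (n.choose k) * ((n : ℝ) - k + 1) /
          (C * (p * ((k : ℝ) - 1) - n + 1) ^ (1 / p)) *
        ((n.factorial : ℝ) ^ ((p + 1) / p) / ((n + 1 - k).factorial : ℝ)) ^ 2 *
        ‖LpForms.dHarmonic D k p ω‖ := by
  have hp1 : 1 ≤ p := Fact.out
  have hp0 : 0 < p := by linarith
  obtain ⟨ζ, rfl⟩ := Submodule.Quotient.mk_surjective _ ω
  have hd : LpForms.dHarmonic D k p (Submodule.Quotient.mk ζ) = LpForms.d D k p ζ := rfl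
  rw [hd]
  -- For `k ≥ n` there are no nonzero `(k+1)`-forms, so every form is closed and its class is zero.
  rcases lt_or_ge k n with hkn | hkn
  · obtain ⟨w, hw⟩ := hD.eq_ball hC
    have hk1 : (0 : ℝ) < k - 1 := by
      have : (2 : ℝ) ≤ k := by exact_mod_cast hk
      linarith
    have hkn' : (k : ℝ) + 1 ≤ n := by exact_mod_cast hkn
    -- The hypothesis gives `p (k - 1) > n - 1`, and adding `2 p ≥ 2` gives more than `p (k + 1) >
    -- n`.
    have hb : (0 : ℝ) < k + 1 - n / p := by
      rw [sub_pos, div_lt_iff₀ hp0]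
      rw [div_lt_iff₀ hk1] at hp
      linarith
    refine (LpForms.norm_mk_le_of_ball (by positivity) hw hb ζ).trans ?_
    exact mul_le_mul_of_nonneg_right (LpForms.cone_constant_le hk hkn hp1 hp hC) (norm_nonneg _)
  · have hsub : Subsingleton (LpForms.Covector n (k + 1)) := by
      have : IsEmpty {J : Finset (Fin n) // J.card = k + 1} := ⟨fun J => by
        have := J.2 ▸ Finset.card_le_univ J.1
        rw [Fintype.card_fin] at this
        omega⟩
      infer_instance
    have hd0 : LpForms.d D k p ζ = 0 :=
      Lp.ext (Filter.Eventually.of_forall fun x => Subsingleton.elim _ _)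
    have h0 : (Submodule.Quotient.mk ζ : LpForms.HarmonicSpace D k p) =
        Submodule.Quotient.mk 0 :=
      (Submodule.Quotient.eq _).2 (by rw [sub_zero, LinearMap.mem_ker, hd0])
    rw [h0, hd0, norm_zero, mul_zero]
    exact (Submodule.Quotient.norm_mk_le _ (0 : LpForms.OmegaPP D k p)).trans norm_zero.le
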